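/- **Setting.** Let $N\ge 1$, let $e_1,\dots,e_N\in\mathbb R^2$ be pairwise different unit vectors, $J_i=[0,\infty)e_i$, $J_i^*=J_i\setminus\{0\}$, and let $J=\bigcup_i J_i$ be the junction, with geodesic distance $d(x,y)=|x-y|$ if $x,y$ lie on a common branch and $d(x,y)=|x|+|y|$ otherwise. Let $L_1,\dots,L_N\in C^2(\mathbb R)$ satisfy $L_i''\ge\gamma$ for some $\gamma>0$. Put $$H_i(p)=\sup_{q\in\mathbb R}(pq-L_i(q)),\qquad H_i^-(p)=\sup_{q\le 0}(pq-L_i(q)),$$ $H(x,p)=H_i(p)$ for $x\in J_i^*$, $p\in\mathbb R$, and $H(0,p)=\max_{i}H_i^-(p_i)$ for $p\in\mathbb R^N$. Let $A(x)=\mathbb R e_i$ for $x\in J_i^*$ and $A(0)=\bigcup_i[0,\infty)e_i$; for $P=pe_i\in A(x)$ let $L(x,P)=L_i(p)$ if $x\in J_i^*$ and $L(0,P)=\min_jL_j(p)$. For $0\le s<t$ and $x,y\in J$ let $$\mathcal D(s,y;t,x)=\inf_X\int_s^tL(X(\tau),\dot X(\tau))\,d\tau\in[-\infty,+\infty],$$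 the infimum over all $X\in W^{1,1}([s,t];\mathbb R^2)$ with $X(s)=y$, $X(t)=x$, $X(\tau)\in J$ for all $\tau\in(s,t)$ and $\dot X(\tau)\in A(X(\tau))$ for a.e. $\tau\in(s,t)$. Put $\mathcal D(t,x;t,x)=0$ and $\mathcal D(t,y;t,x)=+\infty$ if $y\ne x$. For $T>0$ let $C^1_*((0,T)\times J)$ be the set of continuous $u:(0,T)\times J\to\mathbb R$ such that for each $i$ the function $(t,r)\mapsto u(t,re_i)$ is $C^1$ on $(0,T)\times[0,\infty)$. For such $u$, $u_x(t,x)$ is the derivative along $J_i$ if $x\in J_i^*$, and $u_x(t,0)\in\mathbb R^N$ is the vector of the one-sided derivatives along the $N$ branches; $|\cdot|$ is the Euclidean norm. **Theorem.** 1. $\mathcal D(s,y;t,x)$ is finite for $0\le s<t$, $x,y\in J$; $\mathcal D$ is continuous on $\{0<s<t,\ x,y\in J\}$ and lower semi-continuous on $\{0<s\le t,\ x,y\in J\}$. 2. For all $T>0$, $0<s_0<t_0<T$ and $x_0,y_0\in J$ there exist $\phi,\psi\in C^1_*((0,T)\times J)$ and $r>0$ such that: * $\phi\ge\mathcal D(s_0,y_0;\cdot,\cdot)$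 on the ball of radius $r$ about $(t_0,x_0)$ (which is contained in $\{s_0<t<T\}$), with equality at $(t_0,x_0)$, and $\phi_t+H(x_0,\phi_x)\ge0$ at $(t_0,x_0)$; * $\psi\ge\mathcal D(\cdot,\cdot;t_0,x_0)$ on the ball of radius $r$ about $(s_0,y_0)$ (which is contained in $\{0<s<t_0\}$), with equality at $(s_0,y_0)$, and, at $(s_0,y_0)$, $-\psi_s+H(y_0,-\psi_y)\le0$ if $N\ge2$, and $-\psi_s+H_1(-\psi_y)\le0$ if $N=1$. Moreover these functions can be chosen so that for every $R>0$ there is a constant $C_R$, depending only on $R$ and on $L_1,\dots,L_N$ and $J$ (not on $T,s_0,t_0,y_0,x_0$), with $$d(y_0,x_0)\le R\,(t_0-s_0)\ \Longrightarrow\ |\phi_x(t_0,x_0)|+|\psi_y(s_0,y_0)|\le C_R .$$ (In particular, if $t_0-s_0\ge\delta>0$ and $d(y_0,x_0)\le R$, the gradients are bounded by $C_{R/\delta}$.) 3. $\mathcal D$ is semi-concave along the branches: for all $s_0>0$, $y_0\in J$ and every $i$, the function $(t,r)\mapsto\mathcal D(s_0,y_0;t,re_i)$ is locally semi-concave on $(s_0,\infty)\times(0,\infty)$,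 and for all $t_0>0$, $x_0\in J$ and every $j$, the function $(s,r)\mapsto\mathcal D(s,re_j;t_0,x_0)$ is locally semi-concave on $(0,t_0)\times(0,\infty)$. Here $f$ is locally semi-concave on an open set $U$ if every point of $U$ is the centre of a ball in $U$ on which $z\mapsto f(z)-C|z|^2$ is concave for some $C\in\mathbb R$. -/

import Mathlib

open Set MeasureTheory Topology

noncomputable section

/-- The Euclidean plane. -/
abbrev Plane : Type := EuclideanSpace ℝ (Fin 2)

/-- `N` pairwise different unit vectors of the plane; they direct the branches of a junction. -/
structure Junction (N : ℕ) where
  e : Fin N → Plane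
  unit : ∀ i, ‖e i‖ = 1
  inj : Function.Injective e

namespace Junction

variable {N : ℕ} (J : Junction N)

/-- The closed branch `J_i = [0, ∞) e_i`. -/
def branch (i : Fin N) : Set Plane := {x | ∃ r : ℝ, 0 ≤ r ∧ x = r • J.e i}

/-- The open branch `J_i^* = J_i \ {0}`. -/
def openBranch (i : Fin N) : Set Plane := J.branch i \ {0}

/-- The junction, as a subset of the plane: the union of the closed branches. -/
def carrier : Set Plane := ⋃ i, J.branch i

open Classical in
/-- The geodesic distance on the junction. -/
def geoDist (x y : Plane) : ℝ :=
  if ∃ i, x ∈ J.branch i ∧ y ∈ J.branch i then ‖x - y‖ else ‖x‖ + ‖y‖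

open Classical in
/-- The index of the branch that contains a point `x ≠ 0` of the junction
(the value at other points of the plane is never used). -/
def index [NeZero N] (x : Plane) : Fin N :=
  if h : ∃ i, x ∈ J.openBranch i then h.choose else 0

/-- The set `A(x)` of admissible controls: `ℝ e_i` on the open branch `i`, and the union of the
half-lines `[0, ∞) e_i` at the junction point. -/
def controls (x : Plane) : Set Plane :=
  {P | (∃ i, x ∈ J.openBranch i ∧ ∃ p : ℝ, P = p • J.e i) ∨
    (x = 0 ∧ ∃ i, ∃ p : ℝ, 0 ≤ p ∧ P = p • J.e i)}

open Classical in
/-- The Lagrangian on the junction: for `P = p e_i` in `A(x)` it is `L_i(p)` on the open branch `i`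
and `min_j L_j(p)` at the junction point, where `p = |P|` since `p ≥ 0` there. -/
def lagrangian [NeZero N] (L : Fin N → ℝ → ℝ) (x P : Plane) : ℝ :=
  if x = 0 then ⨅ j, L j ‖P‖ else L (J.index x) (inner ℝ (J.e (J.index x)) P)

/-- Admissible trajectories from `(s, y)` to `(t, x)`, where `s < t`. A `W^{1,1}` curve on `[s, t]`
is given by its continuous representative `X` together with its integrable derivative `V`, of
which `X` is a primitive. -/
structure IsTrajectory (s : ℝ) (y : Plane) (t : ℝ) (x : Plane) (X V : ℝ → Plane) : Prop where
  integrable : IntegrableOn V (Icc s t)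
  primitive : ∀ τ ∈ Icc s t, X τ = X s + ∫ σ in s..τ, V σ
  mem_carrier : ∀ τ ∈ Ioo s t, X τ ∈ J.carrier
  mem_controls : ∀ᵐ τ, τ ∈ Ioo s t → V τ ∈ J.controls (X τ)
  left : X s = y
  right : X t = x

open Classical in
/-- The action of a trajectory, in `(-∞, +∞]`. The integrand is bounded below when the `L_i` are,
so its integral over `[s, t]` is either finite or `+∞`. -/
def action [NeZero N] (L : Fin N → ℝ → ℝ) (s t : ℝ) (X V : ℝ → Plane) : EReal :=
  if IntegrableOn (fun τ => J.lagrangian L (X τ) (V τ)) (Icc s t) then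
    ((∫ τ in s..t, J.lagrangian L (X τ) (V τ) : ℝ) : EReal)
  else ⊤

open Classical in
/-- The minimal action `D(s, y; t, x)`: the infimum of the action for `s < t`; it is `0` if
`(s, y) = (t, x)` and `+∞` in the remaining cases. -/
def minAction [NeZero N] (L : Fin N → ℝ → ℝ) (s : ℝ) (y : Plane) (t : ℝ) (x : Plane) : EReal :=
  if s < t then
    ⨅ (X : ℝ → Plane) (V : ℝ → Plane) (_ : J.IsTrajectory s y t x X V), J.action L s t X V
  else if s = t ∧ y = x then 0 else ⊤

/-- The class `C¹_*(J_T)`, `J_T = (0, T) × J`: continuous functions whose restriction to each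
`(0, T) × J_i` is `C¹`, up to the junction point. -/
def IsC1Star (T : ℝ) (u : ℝ → Plane → ℝ) : Prop :=
  ContinuousOn (fun z : ℝ × Plane => u z.1 z.2) (Ioo 0 T ×ˢ J.carrier) ∧
    ∀ i, ContDiffOn ℝ 1 (fun z : ℝ × ℝ => u z.1 (z.2 • J.e i)) (Ioo 0 T ×ˢ Ici 0)

/-- The derivatives of `f` along the branches (one-sided at the junction point). At `x = 0` this is
the vector of the `N` derivatives; at a point `x = ‖x‖ e_i` of the open branch `i`, component `i`
is the derivative of `f` at `x`, and the other components are never used. -/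
def spaceDeriv (f : Plane → ℝ) (x : Plane) : Fin N → ℝ :=
  fun i => derivWithin (fun r : ℝ => f (r • J.e i)) (Ici 0) ‖x‖

open Classical in
/-- The absolute value of a gradient at `x`: Euclidean norm at the junction point, absolute value of
the component of the branch of `x` elsewhere. -/
def gradAbs [NeZero N] (x : Plane) (p : Fin N → ℝ) : ℝ :=
  if x = 0 then Real.sqrt (∑ i, p i ^ 2) else |p (J.index x)|

/-- The Legendre-Fenchel transform `H(p) = sup_q (p q - L(q))`. -/
def legendre (L : ℝ → ℝ) (p : ℝ) : ℝ := ⨆ q : ℝ, (p * q - L q)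

/-- `H^-(p) = sup_{q ≤ 0} (p q - L(q))`. -/
def legendreNeg (L : ℝ → ℝ) (p : ℝ) : ℝ := ⨆ q : Iic (0 : ℝ), (p * q - L q)

open Classical in
/-- The Hamiltonian `H(x, p)` on the junction: `H_i(p_i)` on the open branch `i` and
`max_i H_i^-(p_i)` at the junction point. -/
def hamiltonian [NeZero N] (L : Fin N → ℝ → ℝ) (x : Plane) (p : Fin N → ℝ) : ℝ :=
  if x = 0 then ⨆ i, legendreNeg (L i) (p i)
  else legendre (L (J.index x)) (p (J.index x))

end Junction

/-- `f` is locally semi-concave on `U`: near every point of `U` it becomes concave after a multiple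
of `|z|²` has been subtracted. -/
def LocallySemiconcaveOn (f : ℝ × ℝ → ℝ) (U : Set (ℝ × ℝ)) : Prop :=
  ∀ z ∈ U, ∃ ρ > 0, ∃ C : ℝ, Metric.ball z ρ ⊆ U ∧
    ConcaveOn ℝ (Metric.ball z ρ) (fun w => f w - C * (w.1 ^ 2 + w.2 ^ 2))

end

/-! Everything rests on an explicit formula for the minimal action, obtained by calibration. For an
energy `E`, the line `q ↦ maxSlope Λ E * q - E` is tangent to `Λ` at the speed of energy `E`. For a
path through the junction point, these lines (for `L i (-q)` on the way in, for `L j` on the way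
out), together with `-E ≤ restCost L`, integrate to the lower bound `dualCost`. The path whose two
legs have the speeds of one common energy, with a rest in between only at the lowest energy, attains
the bound (`exists_isOptimal`, `IsOptimal.throughCost_eq`). A path avoiding the junction point stays
in one branch, where constant speed is optimal by convexity. The minimum of the two costs is
`branchCost`, and `minAction_eq` identifies it with the minimal action.

Finiteness and continuity for `s < t` are read off the formula. Lower semi-continuity at `s = t`
comes from the superlinear growth of the Lagrangians.

A minimizer ending on an open branch ends with a leg of constant velocity `q` (`exists_last_leg`).
Moving only the end of that leg gives competitors whose cost `(t - m) * L j ((r - r₀) / (t - m))` is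
bounded by a paraboloid with slopes `-energy (L j) q` in time and `deriv (L j) q` in space
(`exists_quadratic_bound`). Local uniformity of its curvature gives semi-concavity; a single
paraboloid is the test function `φ`. Speeds are bounded in terms of `R` alone
(`exists_isSpeedBound`), hence so are gradients. The function `ψ` comes from time reversal.

At the junction point, `φ` needs a maximum over branches to be large, so one good branch suffices
and crude slopes serve on the others. For `ψ` the maximum must be small, so every branch needs the
slope of energy `E`. The corresponding speed `v` may vanish; a leg of length `r` is therefore run at
speed `v + r^(1/3)`, with an error of order `r^(4/3)`, which is still `C¹` with zero derivative at
`0`. -/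

noncomputable section

/-! ### Convex analysis of a single Lagrangian: energy, speed, slope. -/

/-- A `C²` function of one variable whose second derivative is at least `γ > 0`. -/
structure IsTonelli (γ : ℝ) (Λ : ℝ → ℝ) : Prop where
  pos : 0 < γ
  contDiff : ContDiff ℝ 2 Λ
  le_deriv2 : ∀ q, γ ≤ iteratedDeriv 2 Λ q

/-- The energy `q Λ'(q) - Λ(q)`, i.e. the Legendre transform of `Λ` at `Λ'(q)`. -/
def energy (Λ : ℝ → ℝ) (q : ℝ) : ℝ := q * deriv Λ q - Λ q

/-- The restriction of the energy to `[0, ∞)`, extended to an increasing bijection of `ℝ`. -/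
def energyExt (Λ : ℝ → ℝ) (q : ℝ) : ℝ := energy Λ (max q 0) + min q 0

/-- The nonnegative speed with a given energy `E ≥ -Λ(0)`. -/
def speed (Λ : ℝ → ℝ) (E : ℝ) : ℝ := Function.invFun (energyExt Λ) E

/-- The largest slope `p` of an affine minorant `q ↦ p q - E` of `Λ`. -/
def maxSlope (Λ : ℝ → ℝ) (E : ℝ) : ℝ := deriv Λ (speed Λ E)

/-- The set `D` allows two uses: on `univ` for `Λ - γ/2 q²`, giving strong convexity, and on `[-Q,
Q]` for a large multiple of `q²` minus `Λ`, giving an upper Taylor bound. -/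
theorem tangent_le_of_deriv2_nonneg {D : Set ℝ} (hD : Convex ℝ D) {f f' f'' : ℝ → ℝ}
    (hf : ∀ x, HasDerivAt f (f' x) x) (hf' : ∀ x, HasDerivAt f' (f'' x) x)
    (h : ∀ x ∈ D, 0 ≤ f'' x) {x y : ℝ} (hx : x ∈ D) (hy : y ∈ D) :
    f x + f' x * (y - x) ≤ f y := by
  have hc : ConvexOn ℝ D f := by
    refine convexOn_of_hasDerivWithinAt2_nonneg hD
      (fun z _ => (hf z).continuousAt.continuousWithinAt)
      (fun z _ => (hf z).hasDerivWithinAt) (fun z _ => (hf' z).hasDerivWithinAt)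
      (fun z hz => h z (interior_subset hz))
  rcases lt_trichotomy x y with hxy | rfl | hxy
  · have := hc.le_slope_of_hasDerivAt hx hy hxy (hf x)
    rw [slope_def_field, le_div_iff₀ (by linarith)] at this
    linarith
  · simp
  · have := hc.slope_le_of_hasDerivAt hy hx hxy (hf x)
    rw [slope_def_field, div_le_iff₀ (by linarith)] at this
    linarith

namespace IsTonelli

variable {γ : ℝ} {Λ : ℝ → ℝ}

theorem hasDerivAt (h : IsTonelli γ Λ) (q : ℝ) : HasDerivAt Λ (deriv Λ q) q :=
  (h.contDiff.differentiable (by norm_num) q).hasDerivAt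

theorem contDiff_deriv (h : IsTonelli γ Λ) : ContDiff ℝ 1 (deriv Λ) :=
  ((contDiff_succ_iff_deriv (n := 1)).1 (by simpa [one_add_one_eq_two] using h.contDiff)).2.2

theorem hasDerivAt_deriv (h : IsTonelli γ Λ) (q : ℝ) :
    HasDerivAt (deriv Λ) (iteratedDeriv 2 Λ q) q := by
  have := (h.contDiff_deriv.differentiable (by norm_num) q).hasDerivAt
  rwa [iteratedDeriv_succ, iteratedDeriv_one]

theorem continuous (h : IsTonelli γ Λ) : Continuous Λ := h.contDiff.continuous

theorem continuous_deriv (h : IsTonelli γ Λ) : Continuous (deriv Λ) :=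
  h.contDiff_deriv.continuous

theorem continuous_deriv2 (h : IsTonelli γ Λ) : Continuous (iteratedDeriv 2 Λ) :=
  h.contDiff.continuous_iteratedDeriv 2 le_rfl

theorem comp_neg (h : IsTonelli γ Λ) : IsTonelli γ (fun q => Λ (-q)) where
  pos := h.pos
  contDiff := h.contDiff.comp contDiff_neg
  le_deriv2 q := by
    rw [iteratedDeriv_comp_neg]
    simpa using h.le_deriv2 (-q)

theorem deriv_comp_neg (Λ : ℝ → ℝ) (q : ℝ) : deriv (fun q => Λ (-q)) q = -deriv Λ (-q) :=
  _root_.deriv_comp_neg Λ q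

theorem strictMono_deriv (h : IsTonelli γ Λ) : StrictMono (deriv Λ) :=
  strictMono_of_hasDerivAt_pos h.hasDerivAt_deriv fun q => h.pos.trans_le (h.le_deriv2 q)

theorem quadratic_le (h : IsTonelli γ Λ) (x y : ℝ) :
    Λ x + deriv Λ x * (y - x) + γ / 2 * (y - x) ^ 2 ≤ Λ y := by
  have := tangent_le_of_deriv2_nonneg (D := univ) convex_univ
    (f := fun q => Λ q - γ / 2 * q ^ 2) (f' := fun q => deriv Λ q - γ * q)
    (f'' := fun q => iteratedDeriv 2 Λ q - γ)
    (fun q => ((h.hasDerivAt q).fun_sub (((hasDerivAt_id' q).fun_pow 2).const_mul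
      (γ / 2))).congr_deriv (by simp; ring))
    (fun q => ((h.hasDerivAt_deriv q).fun_sub ((hasDerivAt_id' q).const_mul γ)).congr_deriv
      (by simp))
    (fun q _ => by linarith [h.le_deriv2 q]) (mem_univ x) (mem_univ y)
  nlinarith

theorem tangent_le (h : IsTonelli γ Λ) (x y : ℝ) : Λ x + deriv Λ x * (y - x) ≤ Λ y := by
  have := h.quadratic_le x y
  have := mul_nonneg h.pos.le (sq_nonneg (y - x))
  linarith

theorem exists_le_quadratic (h : IsTonelli γ Λ) (Q : ℝ) :
    ∃ B, 0 ≤ B ∧ ∀ x ∈ Icc (-Q) Q, ∀ y ∈ Icc (-Q) Q,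
      Λ y ≤ Λ x + deriv Λ x * (y - x) + B * (y - x) ^ 2 := by
  obtain ⟨B, hB⟩ := isCompact_Icc.exists_bound_of_continuousOn (s := Icc (-Q) Q)
    h.continuous_deriv2.continuousOn
  refine ⟨|B| / 2, by positivity, fun x hx y hy => ?_⟩
  have := tangent_le_of_deriv2_nonneg (D := Icc (-Q) Q) (convex_Icc _ _)
    (f := fun q => |B| / 2 * q ^ 2 - Λ q) (f' := fun q => |B| * q - deriv Λ q)
    (f'' := fun q => |B| - iteratedDeriv 2 Λ q)
    (fun q => ((((hasDerivAt_id' q).fun_pow 2).const_mul (|B| / 2)).fun_sub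
      (h.hasDerivAt q)).congr_deriv (by simp; ring))
    (fun q => (((hasDerivAt_id' q).const_mul |B|).fun_sub
      (h.hasDerivAt_deriv q)).congr_deriv (by simp))
    (fun q hq => by
      have h1 := hB q hq
      rw [Real.norm_eq_abs] at h1
      linarith [le_abs_self (iteratedDeriv 2 Λ q), le_abs_self B]) hx hy
  nlinarith

/-- Quadratic upper bound for the perspective `(η, a) ↦ η Λ(a / η)`. -/
theorem exists_perspective_le (h : IsTonelli γ Λ) (Q : ℝ) {η : ℝ} (hη : 0 < η) :
    ∃ C, 0 ≤ C ∧ ∀ q ∈ Icc (-Q) Q, ∀ τ₀ τ a a₀ : ℝ, η ≤ τ → a / τ ∈ Icc (-Q) Q → a₀ = q * τ₀ →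
      τ * Λ (a / τ) ≤ τ₀ * Λ q - energy Λ q * (τ - τ₀) + deriv Λ q * (a - a₀)
        + C * ((τ - τ₀) ^ 2 + (a - a₀) ^ 2) := by
  obtain ⟨B, hB0, hB⟩ := h.exists_le_quadratic Q
  refine ⟨B * (2 * (1 + Q ^ 2)) / η, by positivity, fun q hq τ₀ τ a a₀ hτ ha ha₀ => ?_⟩
  have hτ0 : 0 < τ := hη.trans_le hτ
  have h1 := mul_le_mul_of_nonneg_left (hB q hq _ ha) hτ0.le
  -- Taylor's bound at `q` leaves the error `(a - q τ)² / τ`. Its numerator is quadratic in the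
  -- increments because `a₀ = q τ₀`, and `η ≤ τ` controls the denominator.
  have h2 : τ * (a / τ - q) ^ 2 = (a - q * τ) ^ 2 / τ := by field_simp
  have h3 : τ * (a / τ) = a := by field_simp
  have h4 : (a - q * τ) ^ 2 ≤ 2 * (1 + Q ^ 2) * ((τ - τ₀) ^ 2 + (a - a₀) ^ 2) := by
    have e : a - q * τ = (a - a₀) - q * (τ - τ₀) := by rw [ha₀]; ring
    have hq2 : q ^ 2 ≤ Q ^ 2 := sq_le_sq' hq.1 hq.2
    rw [e]
    nlinarith [sq_nonneg ((a - a₀) + q * (τ - τ₀)), sq_nonneg (τ - τ₀), sq_nonneg (a - a₀),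
      mul_nonneg (sub_nonneg.2 hq2) (sq_nonneg (τ - τ₀)), mul_nonneg (sq_nonneg Q) (sq_nonneg (a - a₀))]
  have h5 : (a - q * τ) ^ 2 / τ ≤ 2 * (1 + Q ^ 2) * ((τ - τ₀) ^ 2 + (a - a₀) ^ 2) / η :=
    div_le_div₀ (by positivity) h4 hη hτ
  have h6 := mul_le_mul_of_nonneg_left h5 hB0
  have h7 : τ * (Λ q + deriv Λ q * (a / τ - q) + B * (a / τ - q) ^ 2)
      = τ * Λ q + deriv Λ q * (a - q * τ) + B * ((a - q * τ) ^ 2 / τ) := by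
    rw [← h2]; linear_combination deriv Λ q * h3
  rw [h7] at h1
  have h8 : B * (2 * (1 + Q ^ 2) * ((τ - τ₀) ^ 2 + (a - a₀) ^ 2) / η)
    = B * (2 * (1 + Q ^ 2)) / η * ((τ - τ₀) ^ 2 + (a - a₀) ^ 2) := by ring
  rw [h8] at h6
  have h9 : τ * Λ q + deriv Λ q * (a - q * τ)
      = τ₀ * Λ q - energy Λ q * (τ - τ₀) + deriv Λ q * (a - a₀) := by
    rw [ha₀, energy]; ring
  linarith

/-- Strong convexity at `y` gives the quadratic gain; the remaining term `x * (Λ' y - Λ' x)` is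
nonnegative because `0 ≤ x`. This makes the nonnegative speed a function of the energy. -/
theorem energy_growth (h : IsTonelli γ Λ) {x y : ℝ} (hx : 0 ≤ x) (hxy : x ≤ y) :
    energy Λ x + γ / 2 * (y - x) ^ 2 ≤ energy Λ y := by
  have h1 := h.quadratic_le y x
  have h2 := mul_le_mul_of_nonneg_left (h.strictMono_deriv.monotone hxy) hx
  simp only [energy]
  nlinarith

theorem energy_zero (Λ : ℝ → ℝ) : energy Λ 0 = -Λ 0 := by simp [energy]

theorem energy_mono (h : IsTonelli γ Λ) {x y : ℝ} (hx : 0 ≤ x) (hxy : x ≤ y) :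
    energy Λ x ≤ energy Λ y := by
  have := h.energy_growth hx hxy
  have := mul_nonneg h.pos.le (sq_nonneg (y - x))
  linarith

theorem energyExt_of_nonneg (Λ : ℝ → ℝ) {q : ℝ} (hq : 0 ≤ q) : energyExt Λ q = energy Λ q := by
  simp [energyExt, hq]

theorem energyExt_of_nonpos (Λ : ℝ → ℝ) {q : ℝ} (hq : q ≤ 0) : energyExt Λ q = -Λ 0 + q := by
  simp [energyExt, hq, energy_zero]

theorem strictMono_energyExt (h : IsTonelli γ Λ) : StrictMono (energyExt Λ) := by
  intro x y hxy
  rcases lt_or_ge x 0 with hx | hx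
  · have h1 := h.energy_mono (le_max_right x 0) (max_le_max_right 0 hxy.le)
    have h2 : min x 0 < min y 0 := by rw [min_eq_left hx.le]; exact lt_min hxy hx
    exact add_lt_add_of_le_of_lt h1 h2
  · rw [energyExt_of_nonneg Λ hx, energyExt_of_nonneg Λ (hx.trans hxy.le)]
    have h1 := h.energy_growth hx hxy.le
    have h2 := mul_pos (half_pos h.pos) (pow_pos (sub_pos.2 hxy) 2)
    linarith

theorem continuous_energyExt (h : IsTonelli γ Λ) : Continuous (energyExt Λ) := by
  have := h.continuous
  have := h.continuous_deriv
  unfold energyExt energy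
  fun_prop

theorem surjective_energyExt (h : IsTonelli γ Λ) : Function.Surjective (energyExt Λ) := by
  refine h.continuous_energyExt.surjective ?_ ?_
  · refine Filter.tendsto_atTop_mono' _ (f₁ := fun q => -Λ 0 + γ / 2 * q ^ 2) ?_ ?_
    · filter_upwards [Filter.eventually_ge_atTop 0] with q hq
      rw [energyExt_of_nonneg Λ hq]
      have := h.energy_growth le_rfl hq
      rw [energy_zero] at this
      simpa using this
    · exact Filter.tendsto_atTop_add_const_left _ _
        ((Filter.tendsto_pow_atTop two_ne_zero).const_mul_atTop (half_pos h.pos))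
  · refine (Filter.tendsto_atBot_add_const_left _ (-Λ 0) Filter.tendsto_id).congr' ?_
    filter_upwards [Filter.eventually_le_atBot 0] with q hq
    rw [energyExt_of_nonpos Λ hq]; rfl

theorem energyExt_speed (h : IsTonelli γ Λ) (E : ℝ) : energyExt Λ (speed Λ E) = E :=
  Function.rightInverse_invFun h.surjective_energyExt E

theorem speed_eq_orderIso_symm (h : IsTonelli γ Λ) :
    speed Λ = (StrictMono.orderIsoOfSurjective _ h.strictMono_energyExt
      h.surjective_energyExt).symm := by
  ext E
  apply h.strictMono_energyExt.injective
  rw [h.energyExt_speed]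
  exact ((StrictMono.orderIsoOfSurjective _ h.strictMono_energyExt
      h.surjective_energyExt).apply_symm_apply E).symm

theorem continuous_speed (h : IsTonelli γ Λ) : Continuous (speed Λ) := by
  rw [h.speed_eq_orderIso_symm]
  exact OrderIso.continuous _

theorem strictMono_speed (h : IsTonelli γ Λ) : StrictMono (speed Λ) := by
  rw [h.speed_eq_orderIso_symm]
  exact OrderIso.strictMono _

theorem tendsto_speed (h : IsTonelli γ Λ) : Filter.Tendsto (speed Λ) Filter.atTop Filter.atTop := by
  rw [h.speed_eq_orderIso_symm]
  exact OrderIso.tendsto_atTop _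

theorem speed_neg_zero (h : IsTonelli γ Λ) : speed Λ (-Λ 0) = 0 := by
  apply h.strictMono_energyExt.injective
  rw [h.energyExt_speed, energyExt_of_nonneg Λ le_rfl, energy_zero]

theorem speed_nonneg (h : IsTonelli γ Λ) {E : ℝ} (hE : -Λ 0 ≤ E) : 0 ≤ speed Λ E := by
  rw [← h.speed_neg_zero]
  exact h.strictMono_speed.monotone hE

theorem speed_pos (h : IsTonelli γ Λ) {E : ℝ} (hE : -Λ 0 < E) : 0 < speed Λ E := by
  rw [← h.speed_neg_zero]
  exact h.strictMono_speed hE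

theorem energy_speed (h : IsTonelli γ Λ) {E : ℝ} (hE : -Λ 0 ≤ E) : energy Λ (speed Λ E) = E := by
  rw [← energyExt_of_nonneg Λ (h.speed_nonneg hE), h.energyExt_speed]

theorem le_energy_of_speed_le (h : IsTonelli γ Λ) {E S : ℝ} (hE : -Λ 0 ≤ E) (hS : speed Λ E ≤ S) :
    E ≤ energy Λ S := by
  rw [← h.energy_speed hE]
  exact h.energy_mono (h.speed_nonneg hE) hS

theorem speed_mul_maxSlope (h : IsTonelli γ Λ) {E : ℝ} (hE : -Λ 0 ≤ E) :
    Λ (speed Λ E) = maxSlope Λ E * speed Λ E - E := by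
  have := h.energy_speed hE
  simp only [energy] at this
  rw [maxSlope]; linarith

/-- The tangent at the speed of energy `E` has intercept `-E`. This is the pointwise calibration
inequality, with equality at that speed. -/
theorem maxSlope_mul_sub_le (h : IsTonelli γ Λ) {E : ℝ} (hE : -Λ 0 ≤ E) (q : ℝ) :
    maxSlope Λ E * q - E ≤ Λ q := by
  have h1 := h.tangent_le (speed Λ E) q
  have h2 := h.speed_mul_maxSlope hE
  rw [maxSlope] at *
  linarith

theorem continuous_maxSlope (h : IsTonelli γ Λ) : Continuous (maxSlope Λ) :=
  h.continuous_deriv.comp h.continuous_speed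

/-- Tonelli functions grow faster than linearly. -/
theorem linear_le (h : IsTonelli γ Λ) (k q : ℝ) :
    k * |q| - (-Λ 0 + (k + |deriv Λ 0|) ^ 2 / (2 * γ)) ≤ Λ q := by
  have h1 := h.quadratic_le 0 q
  have hγ := h.pos
  have h2 : (k + |deriv Λ 0|) * |q| ≤ γ / 2 * q ^ 2 + (k + |deriv Λ 0|) ^ 2 / (2 * γ) := by
    have : γ / 2 * q ^ 2 + (k + |deriv Λ 0|) ^ 2 / (2 * γ) - (k + |deriv Λ 0|) * |q|
        = (γ * |q| - (k + |deriv Λ 0|)) ^ 2 / (2 * γ) := by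
      rw [← sq_abs q]; field_simp; ring
    have h3 : 0 ≤ (γ * |q| - (k + |deriv Λ 0|)) ^ 2 / (2 * γ) := by positivity
    linarith
  have h3 : -(|deriv Λ 0| * |q|) ≤ deriv Λ 0 * q := by
    rw [← abs_mul]; exact neg_abs_le _
  simp only [sub_zero] at h1
  nlinarith

theorem exists_le_maxSlope (h : IsTonelli γ Λ) (k : ℝ) : ∃ E₀, ∀ E ≥ E₀, k ≤ maxSlope Λ E := by
  have h1 : ∃ q, k ≤ deriv Λ q := by
    obtain ⟨q, hq⟩ : ∃ q, 0 < q ∧ k - deriv Λ 0 ≤ γ / 2 * q := by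
      refine ⟨max 1 ((k - deriv Λ 0) / (γ / 2)), by positivity, ?_⟩
      have := le_max_right 1 ((k - deriv Λ 0) / (γ / 2))
      rwa [div_le_iff₀ (half_pos h.pos), mul_comm] at this
    refine ⟨q, ?_⟩
    have h2 := h.quadratic_le 0 q
    have h3 := h.tangent_le q 0
    by_contra! hc
    nlinarith [mul_lt_mul_of_pos_right hc hq.1, mul_le_mul_of_nonneg_right hq.2 hq.1.le]
  obtain ⟨q, hq⟩ := h1
  obtain ⟨E₀, hE₀⟩ := Filter.eventually_atTop.1 (h.tendsto_speed.eventually_ge_atTop q)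
  exact ⟨E₀, fun E hE => hq.trans (h.strictMono_deriv.monotone (hE₀ E hE))⟩

end IsTonelli

/-! ### The cost of a path through the junction point, by duality in the energy. -/

section

/-- The dual expression, at energy `E`, of the cost of going to the junction point from distance
`ρ₁` and away from it to distance `ρ₂` in a total time `h`. -/
def dualCost (Λ₁ Λ₂ : ℝ → ℝ) (E h ρ₁ ρ₂ : ℝ) : ℝ :=
  maxSlope Λ₁ E * ρ₁ + maxSlope Λ₂ E * ρ₂ - E * h

/-- The cost of going to the junction point from distance `ρ₁` and away from it to distance `ρ₂`
in a total time `h`, when resting at the junction point costs `ℓ` per unit of time. -/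
def throughCost (Λ₁ Λ₂ : ℝ → ℝ) (ℓ h ρ₁ ρ₂ : ℝ) : ℝ :=
  ⨆ E : Ici (-ℓ), dualCost Λ₁ Λ₂ E h ρ₁ ρ₂

/-- An optimal path through the junction point: it travels with the speeds of energy `E` for the
times `τ₁`, `τ₂`, and rests at the junction point in between only if `E = -ℓ`. -/
structure IsOptimal (Λ₁ Λ₂ : ℝ → ℝ) (ℓ h ρ₁ ρ₂ E τ₁ τ₂ : ℝ) : Prop where
  le_energy : -ℓ ≤ E
  nonneg₁ : 0 ≤ τ₁
  nonneg₂ : 0 ≤ τ₂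
  add_le : τ₁ + τ₂ ≤ h
  eq₁ : ρ₁ = speed Λ₁ E * τ₁
  eq₂ : ρ₂ = speed Λ₂ E * τ₂
  rest : E = -ℓ ∨ τ₁ + τ₂ = h

theorem dualCost_symm (Λ₁ Λ₂ : ℝ → ℝ) (E h ρ₁ ρ₂ : ℝ) :
    dualCost Λ₁ Λ₂ E h ρ₁ ρ₂ = dualCost Λ₂ Λ₁ E h ρ₂ ρ₁ := by
  simp only [dualCost]; ring

theorem throughCost_symm (Λ₁ Λ₂ : ℝ → ℝ) (ℓ h ρ₁ ρ₂ : ℝ) :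
    throughCost Λ₁ Λ₂ ℓ h ρ₁ ρ₂ = throughCost Λ₂ Λ₁ ℓ h ρ₂ ρ₁ := by
  simp only [throughCost, dualCost_symm Λ₁ Λ₂]

variable {γ : ℝ} {Λ Λ₁ Λ₂ : ℝ → ℝ} {ℓ h ρ ρ₁ ρ₂ E τ₁ τ₂ : ℝ}

theorem IsTonelli.tendsto_div_speed (h₁ : IsTonelli γ Λ) (ρ : ℝ) :
    Filter.Tendsto (fun E => ρ / speed Λ E) Filter.atTop (𝓝 0) :=
  h₁.tendsto_speed.const_div_atTop ρ

theorem IsTonelli.continuousOn_div_speed (h₁ : IsTonelli γ Λ) (hℓ : ℓ ≤ Λ 0) (ρ : ℝ) :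
    ContinuousOn (fun E => ρ / speed Λ E) (Ioi (-ℓ)) := by
  refine continuousOn_const.div h₁.continuous_speed.continuousOn fun E hE => ?_
  exact (h₁.speed_pos (by linarith [mem_Ioi.1 hE])).ne'

/-- If the speed vanishes at energy `-ℓ`, bounded travel times force `ρ = 0`, and the convention `0
/ 0 = 0` then gives the right limit. -/
theorem IsTonelli.tendsto_div_speed_nhdsGT (h₁ : IsTonelli γ Λ) (hρ : 0 ≤ ρ)
    (hℓ : ℓ ≤ Λ 0) (hle : ∀ E > -ℓ, ρ / speed Λ E ≤ h) :
    ρ = speed Λ (-ℓ) * (ρ / speed Λ (-ℓ)) ∧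
      Filter.Tendsto (fun E => ρ / speed Λ E) (𝓝[>] (-ℓ)) (𝓝 (ρ / speed Λ (-ℓ))) := by
  have hs : Filter.Tendsto (speed Λ) (𝓝[>] (-ℓ)) (𝓝 (speed Λ (-ℓ))) :=
    (h₁.continuous_speed.tendsto _).mono_left nhdsWithin_le_nhds
  have h2 : ρ ≤ h * speed Λ (-ℓ) := by
    refine le_of_tendsto_of_tendsto tendsto_const_nhds (hs.const_mul h) ?_
    filter_upwards [self_mem_nhdsWithin] with E hE
    have hp := h₁.speed_pos (E := E) (by linarith [mem_Ioi.1 hE])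
    exact (div_le_iff₀ hp).1 (hle E hE)
  rcases eq_or_ne (speed Λ (-ℓ)) 0 with h0 | h0
  · have : ρ = 0 := le_antisymm (by simpa [h0] using h2) hρ
    subst this
    simp
  · exact ⟨by field_simp, tendsto_const_nhds.div hs h0⟩

/-- The travel time at energy `E` is continuous for `E > -ℓ` and tends to `0` as `E → ∞`. If it
reaches `h` somewhere, the intermediate value theorem gives an energy that uses exactly the time
`h`. Otherwise it stays below `h` down to `E = -ℓ`, and the time left over is spent at rest. -/
theorem exists_isOptimal (h₁ : IsTonelli γ Λ₁) (h₂ : IsTonelli γ Λ₂) (hℓ₁ : ℓ ≤ Λ₁ 0)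
    (hℓ₂ : ℓ ≤ Λ₂ 0) (hh : 0 < h) (hρ₁ : 0 ≤ ρ₁) (hρ₂ : 0 ≤ ρ₂) :
    ∃ E τ₁ τ₂, IsOptimal Λ₁ Λ₂ ℓ h ρ₁ ρ₂ E τ₁ τ₂ := by
  have hp₁ : ∀ E > -ℓ, 0 < speed Λ₁ E := fun E hE => h₁.speed_pos (by linarith)
  have hp₂ : ∀ E > -ℓ, 0 < speed Λ₂ E := fun E hE => h₂.speed_pos (by linarith)
  by_cases hc : ∃ E₁ > -ℓ, h ≤ ρ₁ / speed Λ₁ E₁ + ρ₂ / speed Λ₂ E₁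
  · obtain ⟨E₁, hE₁, hE₁h⟩ := hc
    have ht : Filter.Tendsto (fun E => ρ₁ / speed Λ₁ E + ρ₂ / speed Λ₂ E) Filter.atTop (𝓝 0) := by
      simpa using (h₁.tendsto_div_speed ρ₁).add (h₂.tendsto_div_speed ρ₂)
    obtain ⟨E₂, hE₂, hE₂h⟩ :=
      ((Filter.eventually_ge_atTop E₁).and (ht.eventually_lt_const hh)).exists
    have hcont : ContinuousOn (fun E => ρ₁ / speed Λ₁ E + ρ₂ / speed Λ₂ E) (Icc E₁ E₂) :=
      ((h₁.continuousOn_div_speed hℓ₁ ρ₁).add (h₂.continuousOn_div_speed hℓ₂ ρ₂)).mono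
        fun E hE => lt_of_lt_of_le hE₁ hE.1
    obtain ⟨E, hE, hEh⟩ := intermediate_value_Icc' hE₂ hcont ⟨hE₂h.le, hE₁h⟩
    have hE' : -ℓ < E := lt_of_lt_of_le hE₁ hE.1
    have := hp₁ E hE'
    have := hp₂ E hE'
    exact ⟨E, ρ₁ / speed Λ₁ E, ρ₂ / speed Λ₂ E, hE'.le, by positivity, by positivity, hEh.le,
      by field_simp, by field_simp, Or.inr hEh⟩
  · push Not at hc
    have hq₁ : ∀ E > -ℓ, 0 ≤ ρ₁ / speed Λ₁ E := fun E hE => div_nonneg hρ₁ (hp₁ E hE).le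
    have hq₂ : ∀ E > -ℓ, 0 ≤ ρ₂ / speed Λ₂ E := fun E hE => div_nonneg hρ₂ (hp₂ E hE).le
    obtain ⟨e₁, t₁⟩ := h₁.tendsto_div_speed_nhdsGT (h := h) hρ₁ hℓ₁
      fun E hE => by linarith [hc E hE, hq₂ E hE]
    obtain ⟨e₂, t₂⟩ := h₂.tendsto_div_speed_nhdsGT (h := h) hρ₂ hℓ₂
      fun E hE => by linarith [hc E hE, hq₁ E hE]
    refine ⟨-ℓ, ρ₁ / speed Λ₁ (-ℓ), ρ₂ / speed Λ₂ (-ℓ), le_rfl,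
      div_nonneg hρ₁ (h₁.speed_nonneg (by linarith)),
      div_nonneg hρ₂ (h₂.speed_nonneg (by linarith)), ?_, e₁, e₂, Or.inl rfl⟩
    refine le_of_tendsto (t₁.add t₂) ?_
    filter_upwards [self_mem_nhdsWithin] with E hE using (hc E hE).le

namespace IsOptimal

theorem cost_eq (H : IsOptimal Λ₁ Λ₂ ℓ h ρ₁ ρ₂ E τ₁ τ₂) (h₁ : IsTonelli γ Λ₁)
    (h₂ : IsTonelli γ Λ₂) (hℓ₁ : ℓ ≤ Λ₁ 0) (hℓ₂ : ℓ ≤ Λ₂ 0) :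
    τ₁ * Λ₁ (speed Λ₁ E) + (h - τ₁ - τ₂) * ℓ + τ₂ * Λ₂ (speed Λ₂ E)
      = dualCost Λ₁ Λ₂ E h ρ₁ ρ₂ := by
  have hE := H.le_energy
  rw [h₁.speed_mul_maxSlope (E := E) (by linarith), h₂.speed_mul_maxSlope (E := E) (by linarith),
    dualCost, H.eq₁, H.eq₂]
  rcases H.rest with h0 | h0
  · rw [h0]; ring
  · rw [← h0]; ring

/-- The calibration inequalities of energy `E'`, applied to the two legs and the rest of the optimal
path of energy `E`, bound its cost from below; by `cost_eq` that cost is the dual cost at `E`. -/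
theorem dualCost_le (H : IsOptimal Λ₁ Λ₂ ℓ h ρ₁ ρ₂ E τ₁ τ₂) (h₁ : IsTonelli γ Λ₁)
    (h₂ : IsTonelli γ Λ₂) (hℓ₁ : ℓ ≤ Λ₁ 0) (hℓ₂ : ℓ ≤ Λ₂ 0) {E' : ℝ} (hE' : -ℓ ≤ E') :
    dualCost Λ₁ Λ₂ E' h ρ₁ ρ₂ ≤ dualCost Λ₁ Λ₂ E h ρ₁ ρ₂ := by
  rw [← H.cost_eq h₁ h₂ hℓ₁ hℓ₂]
  have a1 := mul_le_mul_of_nonneg_left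
    (h₁.maxSlope_mul_sub_le (E := E') (by linarith) (speed Λ₁ E)) H.nonneg₁
  have a2 := mul_le_mul_of_nonneg_left
    (h₂.maxSlope_mul_sub_le (E := E') (by linarith) (speed Λ₂ E)) H.nonneg₂
  have a3 : (h - τ₁ - τ₂) * (-E') ≤ (h - τ₁ - τ₂) * ℓ :=
    mul_le_mul_of_nonneg_left (by linarith) (by linarith [H.add_le])
  have e : dualCost Λ₁ Λ₂ E' h ρ₁ ρ₂ = τ₁ * (maxSlope Λ₁ E' * speed Λ₁ E - E')
      + (h - τ₁ - τ₂) * (-E') + τ₂ * (maxSlope Λ₂ E' * speed Λ₂ E - E') := by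
    rw [dualCost]
    conv_lhs => rw [H.eq₁, H.eq₂]
    ring
  linarith

theorem throughCost_eq (H : IsOptimal Λ₁ Λ₂ ℓ h ρ₁ ρ₂ E τ₁ τ₂) (h₁ : IsTonelli γ Λ₁)
    (h₂ : IsTonelli γ Λ₂) (hℓ₁ : ℓ ≤ Λ₁ 0) (hℓ₂ : ℓ ≤ Λ₂ 0) :
    throughCost Λ₁ Λ₂ ℓ h ρ₁ ρ₂ = dualCost Λ₁ Λ₂ E h ρ₁ ρ₂ := by
  have hg : IsGreatest (range fun E' : Ici (-ℓ) => dualCost Λ₁ Λ₂ E' h ρ₁ ρ₂)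
      (dualCost Λ₁ Λ₂ E h ρ₁ ρ₂) := by
    refine ⟨⟨⟨E, H.le_energy⟩, rfl⟩, ?_⟩
    rintro _ ⟨E', rfl⟩
    exact H.dualCost_le h₁ h₂ hℓ₁ hℓ₂ E'.2
  exact hg.csSup_eq

/-- On a path that never rests, the two speeds cannot both exceed the bound `S` on the mean speed.
-/
theorem energy_le (H : IsOptimal Λ₁ Λ₂ ℓ h ρ₁ ρ₂ E τ₁ τ₂) (h₁ : IsTonelli γ Λ₁)
    (h₂ : IsTonelli γ Λ₂) (hℓ₁ : ℓ ≤ Λ₁ 0) (hℓ₂ : ℓ ≤ Λ₂ 0) (hh : 0 < h) {S : ℝ}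
    (hS : ρ₁ + ρ₂ ≤ S * h) : E ≤ max (-ℓ) (max (energy Λ₁ S) (energy Λ₂ S)) := by
  have hE := H.le_energy
  rcases H.rest with h0 | h0
  · exact h0.le.trans (le_max_left _ _)
  · refine le_max_of_le_right ?_
    by_cases hv : speed Λ₁ E ≤ S
    · exact le_max_of_le_left (h₁.le_energy_of_speed_le (by linarith) hv)
    by_cases hw : speed Λ₂ E ≤ S
    · exact le_max_of_le_right (h₂.le_energy_of_speed_le (by linarith) hw)
    exfalso
    push Not at hv hw
    rw [H.eq₁, H.eq₂, ← h0] at hS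
    have a1 := mul_le_mul_of_nonneg_right hv.le H.nonneg₁
    have a2 := mul_le_mul_of_nonneg_right hw.le H.nonneg₂
    rcases H.nonneg₁.eq_or_lt with b | b
    · have : 0 < τ₂ := by linarith
      nlinarith
    · nlinarith

end IsOptimal

theorem dualCost_le_throughCost (h₁ : IsTonelli γ Λ₁) (h₂ : IsTonelli γ Λ₂) (hℓ₁ : ℓ ≤ Λ₁ 0)
    (hℓ₂ : ℓ ≤ Λ₂ 0) (hh : 0 < h) (hρ₁ : 0 ≤ ρ₁) (hρ₂ : 0 ≤ ρ₂) (hE : -ℓ ≤ E) :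
    dualCost Λ₁ Λ₂ E h ρ₁ ρ₂ ≤ throughCost Λ₁ Λ₂ ℓ h ρ₁ ρ₂ := by
  obtain ⟨E', τ₁, τ₂, H⟩ := exists_isOptimal h₁ h₂ hℓ₁ hℓ₂ hh hρ₁ hρ₂
  rw [H.throughCost_eq h₁ h₂ hℓ₁ hℓ₂]
  exact H.dualCost_le h₁ h₂ hℓ₁ hℓ₂ hE

/-- A supremum of affine functions: the optimal energy of the first triple is admissible for the
second, and its slopes are bounded because the energy lies in a compact interval. Exchanging the
triples gives local Lipschitz continuity. -/
theorem throughCost_sub_le (h₁ : IsTonelli γ Λ₁) (h₂ : IsTonelli γ Λ₂) (hℓ₁ : ℓ ≤ Λ₁ 0)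
    (hℓ₂ : ℓ ≤ Λ₂ 0) {η S : ℝ} (hη : 0 < η) :
    ∃ C, ∀ h ρ₁ ρ₂ h' ρ₁' ρ₂' : ℝ, η ≤ h → 0 ≤ ρ₁ → 0 ≤ ρ₂ → ρ₁ + ρ₂ ≤ S →
      η ≤ h' → 0 ≤ ρ₁' → 0 ≤ ρ₂' →
      throughCost Λ₁ Λ₂ ℓ h ρ₁ ρ₂ - throughCost Λ₁ Λ₂ ℓ h' ρ₁' ρ₂'
        ≤ C * (|h - h'| + |ρ₁ - ρ₁'| + |ρ₂ - ρ₂'|) := by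
  set Ē := max (-ℓ) (max (energy Λ₁ (S / η)) (energy Λ₂ (S / η)))
  obtain ⟨C₁, hC₁⟩ := isCompact_Icc.exists_bound_of_continuousOn (s := Icc (-ℓ) Ē)
    h₁.continuous_maxSlope.continuousOn
  obtain ⟨C₂, hC₂⟩ := isCompact_Icc.exists_bound_of_continuousOn (s := Icc (-ℓ) Ē)
    h₂.continuous_maxSlope.continuousOn
  obtain ⟨C₃, hC₃⟩ := isCompact_Icc.exists_bound_of_continuousOn (s := Icc (-ℓ) Ē)
    continuousOn_id
  refine ⟨max C₁ (max C₂ C₃), fun h ρ₁ ρ₂ h' ρ₁' ρ₂' hh hρ₁ hρ₂ hS hh' hρ₁' hρ₂' => ?_⟩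
  obtain ⟨E, τ₁, τ₂, H⟩ := exists_isOptimal h₁ h₂ hℓ₁ hℓ₂ (hη.trans_le hh) hρ₁ hρ₂
  have hS' : ρ₁ + ρ₂ ≤ S / η * h := by
    rw [div_mul_eq_mul_div, le_div_iff₀ hη]
    exact mul_le_mul hS hh hη.le (by linarith)
  have hE : E ∈ Icc (-ℓ) Ē := ⟨H.le_energy, H.energy_le h₁ h₂ hℓ₁ hℓ₂ (hη.trans_le hh) hS'⟩
  rw [H.throughCost_eq h₁ h₂ hℓ₁ hℓ₂]
  have h3 := dualCost_le_throughCost h₁ h₂ hℓ₁ hℓ₂ (hη.trans_le hh') hρ₁' hρ₂' hE.1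
  have key : dualCost Λ₁ Λ₂ E h ρ₁ ρ₂ - dualCost Λ₁ Λ₂ E h' ρ₁' ρ₂'
      = maxSlope Λ₁ E * (ρ₁ - ρ₁') + maxSlope Λ₂ E * (ρ₂ - ρ₂') - E * (h - h') := by
    simp only [dualCost]; ring
  set C := max C₁ (max C₂ C₃)
  have b1 : maxSlope Λ₁ E * (ρ₁ - ρ₁') ≤ C * |ρ₁ - ρ₁'| := by
    refine (le_abs_self _).trans ?_
    rw [abs_mul]
    exact mul_le_mul_of_nonneg_right ((hC₁ E hE).trans (le_max_left _ _)) (abs_nonneg _)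
  have b2 : maxSlope Λ₂ E * (ρ₂ - ρ₂') ≤ C * |ρ₂ - ρ₂'| := by
    refine (le_abs_self _).trans ?_
    rw [abs_mul]
    exact mul_le_mul_of_nonneg_right ((hC₂ E hE).trans
      ((le_max_left _ _).trans (le_max_right _ _))) (abs_nonneg _)
  have b3 : -(E * (h - h')) ≤ C * |h - h'| := by
    refine (neg_le_abs _).trans ?_
    rw [abs_mul]
    exact mul_le_mul_of_nonneg_right ((hC₃ E hE).trans
      ((le_max_right _ _).trans (le_max_right _ _))) (abs_nonneg _)
  linarith

theorem continuousOn_throughCost (h₁ : IsTonelli γ Λ₁) (h₂ : IsTonelli γ Λ₂) (hℓ₁ : ℓ ≤ Λ₁ 0)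
    (hℓ₂ : ℓ ≤ Λ₂ 0) :
    ContinuousOn (fun z : ℝ × ℝ × ℝ => throughCost Λ₁ Λ₂ ℓ z.1 z.2.1 z.2.2)
      {z | 0 < z.1 ∧ 0 ≤ z.2.1 ∧ 0 ≤ z.2.2} := by
  rintro ⟨h₀, r₀, r₀'⟩ ⟨hh, hr, hr'⟩
  simp only at hh hr hr'
  obtain ⟨C, hC⟩ := throughCost_sub_le h₁ h₂ hℓ₁ hℓ₂ (half_pos hh) (S := r₀ + r₀' + 1)
  set g : ℝ × ℝ × ℝ → ℝ := fun z => C * (|z.1 - h₀| + |z.2.1 - r₀| + |z.2.2 - r₀'|)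
  have hg : Continuous g := by fun_prop
  have hg0 : Filter.Tendsto g (𝓝[{z | 0 < z.1 ∧ 0 ≤ z.2.1 ∧ 0 ≤ z.2.2}] (h₀, r₀, r₀')) (𝓝 0) := by
    have := (hg.tendsto (h₀, r₀, r₀')).mono_left
      (nhdsWithin_le_nhds (s := {z | 0 < z.1 ∧ 0 ≤ z.2.1 ∧ 0 ≤ z.2.2}))
    simpa [g] using this
  rw [ContinuousWithinAt, tendsto_iff_dist_tendsto_zero]
  refine squeeze_zero' (Filter.Eventually.of_forall fun _ => dist_nonneg) ?_ hg0
  have e1 : ∀ᶠ z : ℝ × ℝ × ℝ in 𝓝 (h₀, r₀, r₀'), h₀ / 2 < z.1 :=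
    continuous_fst.tendsto (h₀, r₀, r₀') |>.eventually_const_lt (half_lt_self hh)
  have e2 : ∀ᶠ z : ℝ × ℝ × ℝ in 𝓝 (h₀, r₀, r₀'), z.2.1 + z.2.2 < r₀ + r₀' + 1 := by
    have : Continuous fun z : ℝ × ℝ × ℝ => z.2.1 + z.2.2 := by fun_prop
    exact (this.tendsto (h₀, r₀, r₀')).eventually_lt_const (by simp)
  filter_upwards [self_mem_nhdsWithin, nhdsWithin_le_nhds e1, nhdsWithin_le_nhds e2]
    with z hz hz1 hz2
  rw [Real.dist_eq, abs_le']
  have a := hC z.1 z.2.1 z.2.2 h₀ r₀ r₀' hz1.le hz.2.1 hz.2.2 hz2.le (by linarith) hr hr'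
  have b := hC h₀ r₀ r₀' z.1 z.2.1 z.2.2 (by linarith) hr hr' (by linarith) hz1.le hz.2.1 hz.2.2
  refine ⟨a, ?_⟩
  rw [abs_sub_comm h₀, abs_sub_comm r₀, abs_sub_comm r₀'] at b
  simp only [g]
  linarith

end

/-! ### Geometry of the junction in branch coordinates. -/

namespace Junction

variable {N : ℕ} (J : Junction N)

open Classical in
/-- The coordinate of `x` along the branch `i`: its norm on that branch, `0` elsewhere. -/
def coord (i : Fin N) (x : Plane) : ℝ := if x ∈ J.branch i then ‖x‖ else 0

variable {J} {i j k : Fin N} {r : ℝ} {x y : Plane}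

theorem norm_smul_e (i : Fin N) (hr : 0 ≤ r) : ‖r • J.e i‖ = r := by
  rw [norm_smul, J.unit, mul_one, Real.norm_of_nonneg hr]

theorem smul_mem_branch (i : Fin N) (hr : 0 ≤ r) : r • J.e i ∈ J.branch i := ⟨r, hr, rfl⟩

theorem branch_subset_carrier (i : Fin N) : J.branch i ⊆ J.carrier := subset_iUnion _ i

theorem smul_mem_carrier (i : Fin N) (hr : 0 ≤ r) : r • J.e i ∈ J.carrier :=
  branch_subset_carrier i (smul_mem_branch i hr)

theorem exists_eq_smul (hx : x ∈ J.carrier) : ∃ i, ∃ r : ℝ, 0 ≤ r ∧ x = r • J.e i := by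
  obtain ⟨i, r, hr, hx⟩ := mem_iUnion.1 hx
  exact ⟨i, r, hr, hx⟩

theorem mem_branch_iff : x ∈ J.branch i ↔ x = ‖x‖ • J.e i := by
  constructor
  · rintro ⟨r, hr, rfl⟩
    rw [norm_smul_e i hr]
  · intro h
    rw [h]
    exact smul_mem_branch i (norm_nonneg x)

theorem isClosed_branch (J : Junction N) (i : Fin N) : IsClosed (J.branch i) := by
  have : J.branch i = {x | x = ‖x‖ • J.e i} := by ext x; exact mem_branch_iff
  rw [this]
  exact isClosed_eq continuous_id (by fun_prop)

theorem zero_mem_branch (i : Fin N) : (0 : Plane) ∈ J.branch i := ⟨0, le_rfl, by simp⟩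

theorem smul_mem_branch_iff (hr : 0 < r) : r • J.e k ∈ J.branch i ↔ k = i := by
  constructor
  · intro h
    rw [mem_branch_iff, norm_smul_e k hr.le] at h
    exact J.inj (smul_right_injective _ hr.ne' h)
  · rintro rfl
    exact smul_mem_branch k hr.le

theorem smul_mem_openBranch (hr : 0 < r) : r • J.e k ∈ J.openBranch k := by
  refine ⟨smul_mem_branch k hr.le, ?_⟩
  have : ‖r • J.e k‖ ≠ 0 := by rw [norm_smul_e k hr.le]; exact hr.ne'
  simpa using this

theorem smul_e_ne_zero (k : Fin N) (hr : 0 < r) : r • J.e k ≠ 0 :=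
  (smul_mem_openBranch hr).2

theorem smul_mem_openBranch_iff (hr : 0 < r) : r • J.e k ∈ J.openBranch i ↔ k = i :=
  ⟨fun h => (smul_mem_branch_iff hr).1 h.1, by rintro rfl; exact smul_mem_openBranch hr⟩

theorem index_smul [NeZero N] (hr : 0 < r) : J.index (r • J.e k) = k := by
  have h : ∃ i, r • J.e k ∈ J.openBranch i := ⟨k, smul_mem_openBranch hr⟩
  rw [index, dif_pos h]
  exact ((smul_mem_openBranch_iff hr).1 h.choose_spec).symm

theorem coord_nonneg (i : Fin N) (x : Plane) : 0 ≤ J.coord i x := by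
  unfold coord; split_ifs <;> positivity

theorem coord_zero (i : Fin N) : J.coord i 0 = 0 := by simp [coord]

theorem coord_smul_self (i : Fin N) (hr : 0 ≤ r) : J.coord i (r • J.e i) = r := by
  rw [coord, if_pos (smul_mem_branch i hr), norm_smul_e i hr]

theorem coord_smul_of_ne (hki : k ≠ i) (hr : 0 ≤ r) : J.coord i (r • J.e k) = 0 := by
  rcases hr.eq_or_lt with rfl | hr
  · simp [coord_zero]
  · rw [coord, if_neg fun h => hki ((smul_mem_branch_iff hr).1 h)]

theorem sum_mul_coord_smul (p : Fin N → ℝ) (k : Fin N) (hr : 0 ≤ r) :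
    ∑ i, p i * J.coord i (r • J.e k) = p k * r := by
  rw [Finset.sum_eq_single k, coord_smul_self k hr]
  · intro i _ hi
    rw [coord_smul_of_ne hi.symm hr, mul_zero]
  · simp

theorem sum_coord_smul_e (hx : x ∈ J.carrier) : ∑ i, J.coord i x • J.e i = x := by
  obtain ⟨k, r, hr, rfl⟩ := exists_eq_smul hx
  rw [Finset.sum_eq_single k, coord_smul_self k hr]
  · intro i _ hi
    rw [coord_smul_of_ne hi.symm hr, zero_smul]
  · simp

theorem eq_smul_of_coord_pos (h : 0 < J.coord i x) : x = J.coord i x • J.e i := by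
  have hx : x ∈ J.branch i := by
    by_contra hx
    simp [coord, hx] at h
  rw [coord, if_pos hx]
  exact mem_branch_iff.1 hx

theorem inner_smul_e (i : Fin N) (r : ℝ) : inner ℝ (J.e i) (r • J.e i) = r := by
  rw [inner_smul_right, real_inner_self_eq_norm_sq, J.unit]; simp

theorem norm_smul_sub_smul_self (i : Fin N) (r r' : ℝ) : ‖r • J.e i - r' • J.e i‖ = |r - r'| := by
  rw [← sub_smul, norm_smul, J.unit, mul_one, Real.norm_eq_abs]

/-- Comparison of geodesic and Euclidean distance. With `c = ‖J.e i - J.e j‖`, the law of cosines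
reduces the squared inequality to `0 ≤ (4 - c^2) * (r - r')^2`. -/
theorem add_le_norm_sub (hij : i ≠ j) {r r' : ℝ} (hr : 0 ≤ r) (hr' : 0 ≤ r') :
    r + r' ≤ 2 / ‖J.e i - J.e j‖ * ‖r • J.e i - r' • J.e j‖ := by
  have hc : 0 < ‖J.e i - J.e j‖ := norm_pos_iff.2 (sub_ne_zero.2 fun h => hij (J.inj h))
  have hc2 : ‖J.e i - J.e j‖ ≤ 2 := by
    have := norm_sub_le (J.e i) (J.e j)
    rw [J.unit, J.unit] at this
    linarith
  rw [div_mul_eq_mul_div, le_div_iff₀ hc]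
  refine le_of_sq_le_sq ?_ (by positivity)
  have e1 := norm_sub_sq_real (r • J.e i) (r' • J.e j)
  have e2 := norm_sub_sq_real (J.e i) (J.e j)
  rw [norm_smul_e i hr, norm_smul_e j hr', inner_smul_left, inner_smul_right] at e1
  rw [J.unit, J.unit] at e2
  simp only [conj_trivial] at e1
  rw [mul_pow, mul_pow, e1]
  set c := ‖J.e i - J.e j‖
  have e3 : inner ℝ (J.e i) (J.e j) = 1 - c ^ 2 / 2 := by linarith
  rw [e3]
  have : c ^ 2 ≤ 4 := by nlinarith
  nlinarith [mul_nonneg (sub_nonneg.2 this) (sq_nonneg (r - r')), mul_nonneg hr hr']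

/-- Different branches are separated linearly in the distance to `0`, so coordinates are Lipschitz
for the Euclidean norm and inherit absolute continuity from trajectories. -/
theorem exists_coord_lipschitz (J : Junction N) : ∃ K : ℝ, 0 ≤ K ∧ ∀ i, ∀ x ∈ J.carrier,
    ∀ y ∈ J.carrier, |J.coord i x - J.coord i y| ≤ K * ‖x - y‖ := by
  obtain ⟨K, hK⟩ := (Set.finite_range fun z : Fin N × Fin N =>
    2 / ‖J.e z.1 - J.e z.2‖).bddAbove
  refine ⟨max K 1, by positivity, fun i x hx y hy => ?_⟩
  obtain ⟨k, r, hr, rfl⟩ := exists_eq_smul hx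
  obtain ⟨l, r', hr', rfl⟩ := exists_eq_smul hy
  by_cases hkl : k = l
  · subst hkl
    rw [norm_smul_sub_smul_self]
    have h1 : |J.coord i (r • J.e k) - J.coord i (r' • J.e k)| ≤ |r - r'| := by
      by_cases hki : k = i
      · subst hki
        rw [coord_smul_self k hr, coord_smul_self k hr']
      · rw [coord_smul_of_ne hki hr, coord_smul_of_ne hki hr']
        simp
    exact h1.trans (le_mul_of_one_le_left (abs_nonneg _) (le_max_right _ _))
  · have h1 := add_le_norm_sub (J := J) hkl hr hr'
    have h2 : 2 / ‖J.e k - J.e l‖ ≤ max K 1 := (hK ⟨(k, l), rfl⟩).trans (le_max_left _ _)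
    have h3 := mul_le_mul_of_nonneg_right h2 (norm_nonneg (r • J.e k - r' • J.e l))
    have b : ∀ m (t : ℝ), 0 ≤ t → J.coord i (t • J.e m) ≤ t := by
      intro m t ht
      unfold coord
      split_ifs
      · rw [norm_smul_e m ht]
      · exact ht
    rw [abs_le]
    constructor <;> linarith [b k r hr, b l r' hr', coord_nonneg (J := J) i (r • J.e k),
      coord_nonneg (J := J) i (r' • J.e l)]

theorem continuousOn_coord (J : Junction N) (i : Fin N) : ContinuousOn (J.coord i) J.carrier := by
  obtain ⟨K, hK0, hK⟩ := J.exists_coord_lipschitz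
  refine (LipschitzOnWith.of_dist_le_mul (K := ⟨K, hK0⟩) fun x hx y hy => ?_).continuousOn
  rw [Real.dist_eq, dist_eq_norm]
  exact hK i x hx y hy

/-- The cost per unit of time of resting at the junction point. -/
def restCost (L : Fin N → ℝ → ℝ) : ℝ := ⨅ j, L j 0

theorem restCost_le (L : Fin N → ℝ → ℝ) (j : Fin N) : restCost L ≤ L j 0 :=
  ciInf_le (Set.finite_range _).bddBelow j

theorem exists_restCost_eq [NeZero N] (L : Fin N → ℝ → ℝ) : ∃ j, L j 0 = restCost L :=
  exists_eq_ciInf_of_finite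

theorem lagrangian_zero [NeZero N] (L : Fin N → ℝ → ℝ) : J.lagrangian L 0 0 = restCost L := by
  simp [lagrangian, restCost]

theorem lagrangian_smul [NeZero N] (L : Fin N → ℝ → ℝ) (hr : 0 < r) (P : Plane) :
    J.lagrangian L (r • J.e k) P = L k (inner ℝ (J.e k) P) := by
  rw [lagrangian, if_neg (smul_e_ne_zero k hr), index_smul hr]

/-! ### Trajectories and the derivatives of their coordinates. -/

namespace IsTrajectory

variable {s t : ℝ} {X V : ℝ → Plane}

theorem intervalIntegrable (H : J.IsTrajectory s y t x X V) (hst : s ≤ t) :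
    IntervalIntegrable V volume s t := by
  rw [intervalIntegrable_iff_integrableOn_Icc_of_le hst]
  exact H.integrable

theorem mem_carrier_Icc (H : J.IsTrajectory s y t x X V) (hy : y ∈ J.carrier) (hx : x ∈ J.carrier)
    {τ : ℝ} (hτ : τ ∈ Icc s t) : X τ ∈ J.carrier := by
  rcases hτ.1.eq_or_lt with rfl | h1
  · rwa [H.left]
  rcases hτ.2.eq_or_lt with rfl | h2
  · rwa [H.right]
  exact H.mem_carrier τ ⟨h1, h2⟩

theorem sub_eq (H : J.IsTrajectory s y t x X V) {a b : ℝ} (ha : a ∈ Icc s t)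
    (hb : b ∈ Icc s t) : X b - X a = ∫ σ in a..b, V σ := by
  have hst := ha.1.trans ha.2
  have hI := H.intervalIntegrable hst
  have i1 : IntervalIntegrable V volume s a :=
    hI.mono_set (by rw [uIcc_of_le ha.1, uIcc_of_le hst]; exact Icc_subset_Icc_right ha.2)
  have i2 : IntervalIntegrable V volume s b :=
    hI.mono_set (by rw [uIcc_of_le hb.1, uIcc_of_le hst]; exact Icc_subset_Icc_right hb.2)
  rw [H.primitive a ha, H.primitive b hb, ← intervalIntegral.integral_interval_sub_left i2 i1]
  abel

theorem restrict (H : J.IsTrajectory s y t x X V) {a b : ℝ} (ha : s ≤ a) (hab : a ≤ b)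
    (hb : b ≤ t) : J.IsTrajectory a (X a) b (X b) X V where
  integrable := H.integrable.mono_set (Icc_subset_Icc ha hb)
  primitive τ hτ := by
    rw [← H.sub_eq ⟨ha, hab.trans hb⟩ ⟨ha.trans hτ.1, hτ.2.trans hb⟩]
    abel
  mem_carrier τ hτ := H.mem_carrier τ ⟨ha.trans_lt hτ.1, hτ.2.trans_le hb⟩
  mem_controls := by
    filter_upwards [H.mem_controls] with τ h hτ
    exact h ⟨ha.trans_lt hτ.1, hτ.2.trans_le hb⟩
  left := rfl
  right := rfl

theorem ae_hasDerivAt (H : J.IsTrajectory s y t x X V) (hst : s ≤ t) :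
    ∀ᵐ τ, τ ∈ Ioo s t → HasDerivAt X (V τ) τ := by
  filter_upwards [(H.intervalIntegrable hst).ae_hasDerivAt_integral] with τ h hτ
  have h1 := h (by rw [uIcc_of_le hst]; exact Ioo_subset_Icc_self hτ) s left_mem_uIcc
  refine (h1.const_add (X s)).congr_of_eventuallyEq ?_
  filter_upwards [Icc_mem_nhds hτ.1 hτ.2] with σ hσ using H.primitive σ hσ

theorem absolutelyContinuous_coord (H : J.IsTrajectory s y t x X V) (hst : s ≤ t)
    (hy : y ∈ J.carrier) (hx : x ∈ J.carrier) (i : Fin N) :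
    AbsolutelyContinuousOnInterval (fun τ => J.coord i (X τ)) s t := by
  obtain ⟨K, hK0, hK⟩ := J.exists_coord_lipschitz
  have hI := (H.intervalIntegrable hst).norm
  have hA := (hI.absolutelyContinuousOnInterval_intervalIntegral (c := s) left_mem_uIcc).const_mul K
  rw [absolutelyContinuousOnInterval_iff] at hA ⊢
  intro ε hε
  obtain ⟨δ, hδ, h⟩ := hA ε hε
  refine ⟨δ, hδ, fun E hE hEδ => lt_of_le_of_lt (Finset.sum_le_sum fun n hn => ?_) (h E hE hEδ)⟩
  have hm := hE.1 n hn
  rw [uIcc_of_le hst] at hm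
  obtain ⟨ha, hb⟩ := hm
  set a := (E.2 n).1
  set b := (E.2 n).2
  have i1 : IntervalIntegrable (fun σ => ‖V σ‖) volume s a :=
    hI.mono_set (by rw [uIcc_of_le ha.1, uIcc_of_le hst]; exact Icc_subset_Icc_right ha.2)
  have i2 : IntervalIntegrable (fun σ => ‖V σ‖) volume s b :=
    hI.mono_set (by rw [uIcc_of_le hb.1, uIcc_of_le hst]; exact Icc_subset_Icc_right hb.2)
  rw [Real.dist_eq, Real.dist_eq, ← mul_sub, abs_mul, abs_of_nonneg hK0,
    intervalIntegral.integral_interval_sub_left i1 i2]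
  refine (hK i _ (H.mem_carrier_Icc hy hx ha) _ (H.mem_carrier_Icc hy hx hb)).trans ?_
  refine mul_le_mul_of_nonneg_left ?_ hK0
  rw [H.sub_eq hb ha]
  exact intervalIntegral.norm_integral_le_abs_integral_norm

/-- Almost everywhere, the coordinates of a trajectory are differentiable, with the derivative
that the control prescribes. -/
theorem ae_coord (H : J.IsTrajectory s y t x X V) (hst : s ≤ t)
    (hy : y ∈ J.carrier) (hx : x ∈ J.carrier) :
    ∀ᵐ τ, τ ∈ Ioo s t → (X τ = 0 ∧ V τ = 0 ∧ ∀ i, deriv (fun σ => J.coord i (X σ)) τ = 0) ∨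
      ∃ k, X τ = J.coord k (X τ) • J.e k ∧ 0 < J.coord k (X τ) ∧
        (∀ i, i ≠ k → deriv (fun σ => J.coord i (X σ)) τ = 0) ∧
        deriv (fun σ => J.coord k (X σ)) τ = inner ℝ (J.e k) (V τ) := by
  have hd : ∀ᵐ τ, ∀ i, τ ∈ uIcc s t → DifferentiableAt ℝ (fun σ => J.coord i (X σ)) τ :=
    ae_all_iff.2 fun i => (H.absolutelyContinuous_coord hst hy hx i).ae_differentiableAt
  filter_upwards [hd, H.ae_hasDerivAt hst] with τ hd hX hτ
  have hτ' : τ ∈ uIcc s t := by rw [uIcc_of_le hst]; exact Ioo_subset_Icc_self hτ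
  have hX := hX hτ
  have hev : ∀ᶠ σ in 𝓝 τ, X σ ∈ J.carrier := by
    filter_upwards [Ioo_mem_nhds hτ.1 hτ.2] with σ hσ using H.mem_carrier σ hσ
  by_cases h0 : X τ = 0
  · left
    have hder : ∀ i, deriv (fun σ => J.coord i (X σ)) τ = 0 := by
      intro i
      -- When `X τ = 0` every coordinate attains its minimum `0`, so its derivative vanishes, and `V
      -- τ = 0` follows. Hence almost all time spent at the junction point is charged at `restCost
      -- L`.
      refine IsLocalMin.deriv_eq_zero (Filter.Eventually.of_forall fun σ => ?_)
      simp only [h0, coord_zero]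
      exact coord_nonneg i _
    refine ⟨h0, ?_, hder⟩
    have h1 : HasDerivAt (fun σ => ∑ i, J.coord i (X σ) • J.e i) (∑ i : Fin N, (0 : ℝ) • J.e i) τ := by
      refine HasDerivAt.fun_sum fun i _ => ?_
      have := (hd i hτ').hasDerivAt
      rw [hder i] at this
      exact this.smul_const _
    have h2 : HasDerivAt X (∑ i : Fin N, (0 : ℝ) • J.e i) τ := by
      refine h1.congr_of_eventuallyEq ?_
      filter_upwards [hev] with σ hσ using (sum_coord_smul_e hσ).symm
    simpa using hX.unique h2
  · right
    obtain ⟨k, r, hr, hXr⟩ := exists_eq_smul (H.mem_carrier τ hτ)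
    have hr0 : 0 < r := hr.lt_of_ne (by rintro rfl; simp [hXr] at h0)
    have hk : J.coord k (X τ) = r := by rw [hXr, coord_smul_self k hr]
    have hpos : ∀ᶠ σ in 𝓝 τ, 0 < J.coord k (X σ) :=
      (hd k hτ').continuousAt.eventually_const_lt (by simpa [hk] using hr0)
    refine ⟨k, by rw [hk, hXr], hk ▸ hr0, fun i hi => ?_, ?_⟩
    · have : (fun σ => J.coord i (X σ)) =ᶠ[𝓝 τ] fun _ => 0 := by
        filter_upwards [hpos] with σ hσ
        rw [eq_smul_of_coord_pos hσ, coord_smul_of_ne hi.symm hσ.le]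
      rw [this.deriv_eq, deriv_const]
    · have : (fun σ => J.coord k (X σ)) =ᶠ[𝓝 τ] fun σ => inner ℝ (J.e k) (X σ) := by
        filter_upwards [hpos] with σ hσ
        conv_rhs => rw [eq_smul_of_coord_pos hσ]
        rw [inner_smul_e]
      rw [this.deriv_eq]
      have := (hasDerivAt_const τ (J.e k)).inner ℝ hX
      rw [this.deriv]
      simp

end IsTrajectory

end Junction

/-! ### Lower bound of the action by calibration. -/

namespace Junction

variable {N : ℕ} {J : Junction N} {i j k : Fin N} {r s t : ℝ} {x y z : Plane}

namespace IsTrajectory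

variable {X V : ℝ → Plane}

/-- Lower bound of the action by a calibration `∑ k, p k * coord k` with energy `E`. -/
theorem calibration_le [NeZero N] {L : Fin N → ℝ → ℝ} (H : J.IsTrajectory s y t x X V)
    (hst : s ≤ t) (hy : y ∈ J.carrier) (hx : x ∈ J.carrier)
    (hI : IntegrableOn (fun τ => J.lagrangian L (X τ) (V τ)) (Icc s t)) {p : Fin N → ℝ} {E : ℝ}
    (hp : ∀ τ ∈ Ioo s t, ∀ k, 0 < J.coord k (X τ) → ∀ q, p k * q - E ≤ L k q)
    (hz : ∀ τ ∈ Ioo s t, X τ = 0 → -E ≤ restCost L) :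
    ∑ k, p k * J.coord k x - ∑ k, p k * J.coord k y - E * (t - s)
      ≤ ∫ τ in s..t, J.lagrangian L (X τ) (V τ) := by
  have hA := fun k => H.absolutelyContinuous_coord hst hy hx k
  have hi : ∀ k, IntervalIntegrable (fun τ => p k * deriv (fun σ => J.coord k (X σ)) τ) volume s t :=
    fun k => (hA k).intervalIntegrable_deriv.const_mul _
  have hsum : IntervalIntegrable
      (fun τ => ∑ k, p k * deriv (fun σ => J.coord k (X σ)) τ) volume s t := by
    simpa only [Finset.sum_fn] using IntervalIntegrable.sum Finset.univ fun k _ => hi k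
  have e1 : ∫ τ in s..t, (∑ k, p k * deriv (fun σ => J.coord k (X σ)) τ - E)
      = ∑ k, p k * J.coord k x - ∑ k, p k * J.coord k y - E * (t - s) := by
    rw [intervalIntegral.integral_sub hsum intervalIntegrable_const,
      intervalIntegral.integral_finsetSum fun k _ => hi k, intervalIntegral.integral_const,
      smul_eq_mul, mul_comm E, ← Finset.sum_sub_distrib]
    congr 1
    refine Finset.sum_congr rfl fun k _ => ?_
    rw [intervalIntegral.integral_const_mul, (hA k).integral_deriv_eq_sub, H.left, H.right, mul_sub]
  rw [← e1]
  refine intervalIntegral.integral_mono_ae_restrict hst (hsum.sub intervalIntegrable_const)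
    ((intervalIntegrable_iff_integrableOn_Icc_of_le hst).2 hI) ?_
  rw [← Measure.restrict_congr_set Ioo_ae_eq_Icc, Filter.EventuallyLE,
    ae_restrict_iff' measurableSet_Ioo]
  filter_upwards [H.ae_coord hst hy hx] with τ h hτ
  rcases h hτ with ⟨h0, hV, hd⟩ | ⟨k, hk, hpos, hd, hdk⟩
  · rw [h0, hV, lagrangian_zero]
    simp only [hd, mul_zero, Finset.sum_const_zero, zero_sub]
    exact hz τ hτ h0
  · rw [Finset.sum_eq_single k (fun i _ hi => by rw [hd i hi, mul_zero]) (by simp), hdk]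
    conv_rhs => rw [hk]
    rw [lagrangian_smul L hpos]
    exact hp τ hτ k hpos _

theorem continuousOn (H : J.IsTrajectory s y t x X V) (hst : s ≤ t) :
    ContinuousOn X (Icc s t) := by
  have h1 : ContinuousOn (fun τ => X s + ∫ σ in s..τ, V σ) (Icc s t) := by
    refine continuousOn_const.add ?_
    have := intervalIntegral.continuousOn_primitive_interval (μ := volume) (f := V) (a := s) (b := t)
      (by rw [uIcc_of_le hst]; exact H.integrable)
    rwa [uIcc_of_le hst] at this
  exact h1.congr fun τ hτ => H.primitive τ hτ

/-- A trajectory that avoids the junction point stays in the branch where it starts. -/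
theorem coord_pos (H : J.IsTrajectory s y t x X V) (hst : s ≤ t)
    (hy : y ∈ J.carrier) (hx : x ∈ J.carrier) (h0 : ∀ σ ∈ Icc s t, X σ ≠ 0)
    (hi : 0 < J.coord i y) {τ : ℝ} (hτ : τ ∈ Icc s t) : 0 < J.coord i (X τ) := by
  by_contra hneg
  have hz : J.coord i (X τ) = 0 := le_antisymm (not_lt.1 hneg) (coord_nonneg i _)
  -- On the junction this function is `‖X‖` on branch `i` and `-‖X‖` off it, so leaving the branch
  -- forces a zero of `X`.
  have hc : ContinuousOn (fun σ => 2 * J.coord i (X σ) - ‖X σ‖) (Icc s τ) := by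
    have hX := (H.continuousOn hst).mono (Icc_subset_Icc_right hτ.2)
    refine (continuousOn_const.mul ?_).sub hX.norm
    exact (J.continuousOn_coord i).comp hX fun σ hσ =>
      H.mem_carrier_Icc hy hx ⟨hσ.1, hσ.2.trans hτ.2⟩
  have h1 : 0 ≤ 2 * J.coord i (X s) - ‖X s‖ := by
    rw [H.left]
    have := congrArg norm (eq_smul_of_coord_pos hi)
    rw [norm_smul_e i hi.le] at this
    linarith
  have h2 : 2 * J.coord i (X τ) - ‖X τ‖ ≤ 0 := by
    rw [hz]; linarith [norm_nonneg (X τ)]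
  obtain ⟨σ, hσ, hσ0⟩ := intermediate_value_Icc' hτ.1 hc ⟨h2, h1⟩
  have hσ' : σ ∈ Icc s t := ⟨hσ.1, hσ.2.trans hτ.2⟩
  have hne := norm_pos_iff.2 (h0 σ hσ')
  simp only at hσ0
  have hp : 0 < J.coord i (X σ) := by linarith
  have := congrArg norm (eq_smul_of_coord_pos hp)
  rw [norm_smul_e i hp.le] at this
  linarith

end IsTrajectory

/-- The point `x` at time `t` can be reached from `y` at time `s` with an action at most `a`. -/
def Reach [NeZero N] (J : Junction N) (L : Fin N → ℝ → ℝ) (s : ℝ) (y : Plane) (t : ℝ) (x : Plane)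
    (a : ℝ) : Prop :=
  ∃ X V, J.IsTrajectory s y t x X V ∧
    IntegrableOn (fun τ => J.lagrangian L (X τ) (V τ)) (Icc s t) ∧
    ∫ τ in s..t, J.lagrangian L (X τ) (V τ) ≤ a

/-- The minimal action between the points at distances `ρ` and `ρ'` on the branches `i` and `j`
in a time `h`. -/
def branchCost (L : Fin N → ℝ → ℝ) (i j : Fin N) (h ρ ρ' : ℝ) : ℝ :=
  if i = j then min (h * L i ((ρ' - ρ) / h))
    (throughCost (fun q => L i (-q)) (L j) (restCost L) h ρ ρ')
  else throughCost (fun q => L i (-q)) (L j) (restCost L) h ρ ρ'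

theorem branchCost_le_throughCost (L : Fin N → ℝ → ℝ) (i j : Fin N) (h ρ ρ' : ℝ) :
    branchCost L i j h ρ ρ' ≤ throughCost (fun q => L i (-q)) (L j) (restCost L) h ρ ρ' := by
  unfold branchCost
  split_ifs
  · exact min_le_right _ _
  · exact le_rfl

variable {γ : ℝ} {L : Fin N → ℝ → ℝ} {a b m ρ ρ' : ℝ}

theorem restCost_le_neg (L : Fin N → ℝ → ℝ) (i : Fin N) :
    restCost L ≤ (fun q => L i (-q)) 0 := by simpa using restCost_le L i

/-- A trajectory meeting `0` is cut at such a time and calibrated on both pieces at the optimal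
energy, which adds up to the dual cost. Otherwise it stays in branch `i`, where the tangent of `L i`
at the mean velocity calibrates it, as in Jensen's inequality. -/
theorem Reach.branchCost_le [NeZero N] (hL : ∀ i, IsTonelli γ (L i)) (hst : s < t) (hρ : 0 ≤ ρ)
    (hρ' : 0 ≤ ρ') (H : J.Reach L s (ρ • J.e i) t (ρ' • J.e j) a) :
    branchCost L i j (t - s) ρ ρ' ≤ a := by
  obtain ⟨X, V, H, hI, ha⟩ := H
  have hy : ρ • J.e i ∈ J.carrier := smul_mem_carrier i hρ
  have hx : ρ' • J.e j ∈ J.carrier := smul_mem_carrier j hρ'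
  refine le_trans ?_ ha
  have hh : 0 < t - s := sub_pos.2 hst
  by_cases h0 : ∃ σ ∈ Icc s t, X σ = 0
  · refine (branchCost_le_throughCost L i j _ _ _).trans ?_
    obtain ⟨E, τ₁, τ₂, O⟩ := exists_isOptimal (hL i).comp_neg (hL j) (restCost_le_neg L i)
      (restCost_le L j) hh hρ hρ'
    rw [O.throughCost_eq (hL i).comp_neg (hL j) (restCost_le_neg L i) (restCost_le L j)]
    obtain ⟨σ, hσ, h0⟩ := h0
    have hE := O.le_energy
    have hXσ : X σ ∈ J.carrier := H.mem_carrier_Icc hy hx hσ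
    have H1 := H.restrict le_rfl hσ.1 hσ.2
    have H2 := H.restrict hσ.1 hσ.2 le_rfl
    have I1 := hI.mono_set (Icc_subset_Icc_right hσ.2)
    have I2 := hI.mono_set (Icc_subset_Icc_left hσ.1)
    have c1 := H1.calibration_le hσ.1 (by rwa [H.left]) hXσ I1
      -- Before `σ` the motion is towards the junction point, hence the reflected Lagrangian and the
      -- sign.
      (p := fun k => -maxSlope (fun q => L k (-q)) E) (E := E)
      (fun τ _ k _ q => by
        have := (hL k).comp_neg.maxSlope_mul_sub_le (E := E)
          (by linarith [restCost_le_neg L k]) (-q)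
        simp only [neg_neg] at this
        linarith) (fun _ _ _ => by linarith)
    have c2 := H2.calibration_le hσ.2 hXσ (by rwa [H.right]) I2
      (p := fun k => maxSlope (L k) E) (E := E)
      (fun τ _ k _ q => (hL k).maxSlope_mul_sub_le (by linarith [restCost_le L k]) q)
      (fun _ _ _ => by linarith)
    rw [← intervalIntegral.integral_add_adjacent_intervals
      ((intervalIntegrable_iff_integrableOn_Icc_of_le hσ.1).2 I1)
      ((intervalIntegrable_iff_integrableOn_Icc_of_le hσ.2).2 I2)]
    rw [H.left, h0, sum_mul_coord_smul _ i hρ] at c1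
    rw [H.right, h0, sum_mul_coord_smul _ j hρ'] at c2
    simp only [coord_zero, mul_zero, Finset.sum_const_zero] at c1 c2
    simp only [dualCost]
    linarith
  · push Not at h0
    have hρ0 : 0 < ρ := hρ.lt_of_ne (by
      rintro rfl
      exact h0 s ⟨le_rfl, hst.le⟩ (by rw [H.left]; simp))
    have hpos := fun τ (hτ : τ ∈ Icc s t) => H.coord_pos (i := i) hst.le hy hx h0
      (by rwa [coord_smul_self i hρ]) hτ
    have hij : i = j := by
      by_contra hij
      have := hpos t ⟨hst.le, le_rfl⟩
      rw [H.right, coord_smul_of_ne (Ne.symm hij) hρ'] at this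
      exact this.false
    subst hij
    rw [branchCost, if_pos rfl]
    refine (min_le_left _ _).trans ?_
    set q₀ := (ρ' - ρ) / (t - s)
    have c := H.calibration_le hst.le hy hx hI (p := fun _ => deriv (L i) q₀)
      (E := energy (L i) q₀)
      (fun τ hτ k hk q => by
        have hki : k = i := by
          have h1 := hpos τ (Ioo_subset_Icc_self hτ)
          rw [eq_smul_of_coord_pos hk] at h1
          by_contra hki
          rw [coord_smul_of_ne hki (coord_nonneg _ _)] at h1
          exact h1.false
        subst hki
        have := (hL k).tangent_le q₀ q
        simp only [energy]
        linarith)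
      (fun τ hτ hX => (h0 τ (Ioo_subset_Icc_self hτ) hX).elim)
    rw [sum_mul_coord_smul _ i hρ, sum_mul_coord_smul _ i hρ'] at c
    have hq : q₀ * (t - s) = ρ' - ρ := div_mul_cancel₀ _ hh.ne'
    simp only [energy] at c
    have e : (t - s) * L i q₀ = deriv (L i) q₀ * ρ' - deriv (L i) q₀ * ρ
        - (q₀ * deriv (L i) q₀ - L i q₀) * (t - s) := by
      linear_combination (deriv (L i) q₀) * hq
    rw [e]
    exact c

theorem branchCost_neg (L : Fin N → ℝ → ℝ) (i j : Fin N) (h ρ ρ' : ℝ) :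
    branchCost (fun k q => L k (-q)) j i h ρ' ρ = branchCost L i j h ρ ρ' := by
  have e1 : restCost (fun k q => L k (-q)) = restCost L := by simp [restCost]
  have e2 : throughCost (fun q => L j (- -q)) (fun q => L i (-q)) (restCost L) h ρ' ρ
      = throughCost (fun q => L i (-q)) (L j) (restCost L) h ρ ρ' := by
    simp only [neg_neg]
    exact throughCost_symm _ _ _ _ _ _
  simp only [branchCost, e1, e2]
  by_cases hij : i = j
  · subst hij
    rw [if_pos rfl, if_pos rfl, ← neg_div, neg_sub]
  · rw [if_neg hij, if_neg (Ne.symm hij)]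

end Junction

/-! ### Competitors, and the explicit formula for the minimal action. -/

namespace Junction

variable {N : ℕ} [NeZero N] {J : Junction N} {i j k : Fin N} {s t : ℝ} {x y z : Plane}
  {γ : ℝ} {L : Fin N → ℝ → ℝ} {a b m q ρ ρ' : ℝ}

theorem Reach.mono (H : J.Reach L s y t x a) (hab : a ≤ b) : J.Reach L s y t x b := by
  obtain ⟨X, V, H, hI, ha⟩ := H
  exact ⟨X, V, H, hI, ha.trans hab⟩

/-- Motion at constant speed along a branch. -/
theorem reach_leg (J : Junction N) (L : Fin N → ℝ → ℝ) (i : Fin N) (hst : s ≤ t) (hρ : 0 ≤ ρ)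
    (hρ' : 0 ≤ ρ') (hq : ρ' - ρ = q * (t - s)) :
    J.Reach L s (ρ • J.e i) t (ρ' • J.e i) ((t - s) * L i q) := by
  set X : ℝ → Plane := fun τ => (ρ + q * (τ - s)) • J.e i
  set V : ℝ → Plane := fun _ => q • J.e i
  have hnn : ∀ τ ∈ Icc s t, 0 ≤ ρ + q * (τ - s) := by
    intro τ hτ
    rcases le_total 0 q with h | h
    · have := mul_nonneg h (sub_nonneg.2 hτ.1)
      linarith
    · nlinarith [mul_nonneg (neg_nonneg.2 h) (sub_nonneg.2 hτ.2)]
  -- A leg resting at the junction point pays the minimum over all branches instead of `L i 0`,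
  -- which can only lower the action.
  set c : ℝ := if q = 0 ∧ ρ = 0 then restCost L else L i q with hc
  have hcle : c ≤ L i q := by
    rw [hc]
    split_ifs with h
    · rw [h.1]; exact restCost_le L i
    · exact le_rfl
  have hae : ∀ᵐ τ, τ ∈ Ioo s t → (0 < ρ + q * (τ - s) ∨ q = 0 ∧ ρ = 0) := by
    -- A moving leg meets `0` at most at this one time; for `q = 0` the excluded value is just `s`.
    have : ∀ᵐ τ : ℝ, τ ≠ s - ρ / q := by simp [ae_iff, measure_singleton]
    filter_upwards [this] with τ hne hτ
    rcases (hnn τ (Ioo_subset_Icc_self hτ)).lt_or_eq with h | h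
    · exact Or.inl h
    · right
      have hq0 : q = 0 := by
        by_contra hq0
        apply hne
        field_simp
        linarith
      exact ⟨hq0, by simpa [hq0] using h.symm⟩
  have hlag : ∀ᵐ τ, τ ∈ Ioo s t → J.lagrangian L (X τ) (V τ) = c := by
    filter_upwards [hae] with τ h hτ
    rcases h hτ with h | h
    · have hn : ¬(q = 0 ∧ ρ = 0) := by rintro ⟨h1, h2⟩; simp [h1, h2] at h
      rw [hc, if_neg hn, lagrangian_smul L h, inner_smul_e]
    · rw [hc, if_pos h]
      simp only [X, V, h.1, h.2, zero_mul, add_zero, zero_smul]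
      exact lagrangian_zero L
  have hlag' : (fun τ => J.lagrangian L (X τ) (V τ)) =ᵐ[volume.restrict (Icc s t)] fun _ => c := by
    rw [← Measure.restrict_congr_set Ioo_ae_eq_Icc, Filter.EventuallyEq,
      ae_restrict_iff' measurableSet_Ioo]
    exact hlag
  refine ⟨X, V, ⟨integrableOn_const (by simp), fun τ _ => ?_, fun τ hτ =>
    smul_mem_carrier i (hnn τ (Ioo_subset_Icc_self hτ)), ?_, ?_, ?_⟩, ?_, ?_⟩
  · rw [intervalIntegral.integral_const, smul_smul]
    simp only [X]
    rw [← add_smul]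
    congr 1
    ring
  · filter_upwards [hae] with τ h hτ
    rcases h hτ with h | h
    · exact Or.inl ⟨i, smul_mem_openBranch h, q, rfl⟩
    · exact Or.inr ⟨by simp [X, h.1, h.2], i, 0, le_rfl, by simp [V, h.1]⟩
  · simp [X]
  · simp only [X]; congr 1; linarith
  · exact (integrableOn_const (C := c) (by simp)).congr_fun_ae hlag'.symm
  · have e : ∫ τ in s..t, J.lagrangian L (X τ) (V τ) = ∫ _ in s..t, c := by
      rw [intervalIntegral.integral_of_le hst, intervalIntegral.integral_of_le hst,
        ← integral_Icc_eq_integral_Ioc, ← integral_Icc_eq_integral_Ioc]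
      exact integral_congr_ae hlag'
    rw [e, intervalIntegral.integral_const, smul_eq_mul]
    exact mul_le_mul_of_nonneg_left hcle (sub_nonneg.2 hst)

/-- Rest at the junction point. -/
theorem reach_rest (J : Junction N) (L : Fin N → ℝ → ℝ) (hst : s ≤ t) :
    J.Reach L s 0 t 0 ((t - s) * restCost L) := by
  obtain ⟨j, hj⟩ := exists_restCost_eq L
  rw [← hj]
  simpa using reach_leg J L j hst le_rfl le_rfl (q := 0) (by simp)

theorem Reach.trans (h1 : s ≤ m) (h2 : m ≤ t) (hz : z ∈ J.carrier) (H₁ : J.Reach L s y m z a)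
    (H₂ : J.Reach L m z t x b) : J.Reach L s y t x (a + b) := by
  obtain ⟨X₁, V₁, H₁, I₁, ha⟩ := H₁
  obtain ⟨X₂, V₂, H₂, I₂, hb⟩ := H₂
  set X : ℝ → Plane := fun τ => if τ ≤ m then X₁ τ else X₂ τ
  set V : ℝ → Plane := fun τ => if τ ≤ m then V₁ τ else V₂ τ
  have X1 : ∀ τ ≤ m, X τ = X₁ τ := fun τ h => if_pos h
  have V1 : ∀ τ ≤ m, V τ = V₁ τ := fun τ h => if_pos h
  have X2 : ∀ τ, m < τ → X τ = X₂ τ := fun τ h => if_neg h.not_ge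
  have V2 : ∀ τ, m < τ → V τ = V₂ τ := fun τ h => if_neg h.not_ge
  have hunion : Icc s t = Icc s m ∪ Ioc m t := (Icc_union_Ioc_eq_Icc h1 h2).symm
  have hV1 : IntegrableOn V (Icc s m) :=
    H₁.integrable.congr_fun (fun τ hτ => (V1 τ hτ.2).symm) measurableSet_Icc
  have hV2 : IntegrableOn V (Ioc m t) :=
    (H₂.integrable.mono_set Ioc_subset_Icc_self).congr_fun (fun τ hτ => (V2 τ hτ.1).symm)
      measurableSet_Ioc
  have hV : IntegrableOn V (Icc s t) := by rw [hunion]; exact hV1.union hV2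
  have hL1 : IntegrableOn (fun τ => J.lagrangian L (X τ) (V τ)) (Icc s m) :=
    I₁.congr_fun (fun τ hτ => by simp only [X1 τ hτ.2, V1 τ hτ.2]) measurableSet_Icc
  have hL2 : IntegrableOn (fun τ => J.lagrangian L (X τ) (V τ)) (Ioc m t) :=
    (I₂.mono_set Ioc_subset_Icc_self).congr_fun
      (fun τ hτ => by simp only [X2 τ hτ.1, V2 τ hτ.1]) measurableSet_Ioc
  have p1 : ∀ τ ∈ Icc s m, ∫ σ in s..τ, V σ = ∫ σ in s..τ, V₁ σ := fun τ hτ =>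
    intervalIntegral.integral_congr fun σ hσ => V1 σ (by
      rw [uIcc_of_le hτ.1] at hσ; exact hσ.2.trans hτ.2)
  refine ⟨X, V, ⟨hV, fun τ hτ => ?_, fun τ hτ => ?_, ?_, by rw [X1 s h1, H₁.left], ?_⟩, ?_, ?_⟩
  · rcases le_or_gt τ m with h | h
    · rw [X1 τ h, X1 s h1, p1 τ ⟨hτ.1, h⟩]
      exact H₁.primitive τ ⟨hτ.1, h⟩
    · have e : ∫ σ in m..τ, V σ = ∫ σ in m..τ, V₂ σ := by
        rw [intervalIntegral.integral_of_le h.le, intervalIntegral.integral_of_le h.le]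
        exact setIntegral_congr_fun measurableSet_Ioc fun σ hσ => V2 σ hσ.1
      have i1 : IntervalIntegrable V volume s m :=
        (intervalIntegrable_iff_integrableOn_Icc_of_le h1).2 hV1
      have i2 : IntervalIntegrable V volume m τ :=
        (intervalIntegrable_iff_integrableOn_Ioc_of_le h.le).2
          (hV2.mono_set (Ioc_subset_Ioc_right hτ.2))
      rw [← intervalIntegral.integral_add_adjacent_intervals i1 i2, p1 m ⟨h1, le_rfl⟩, e,
        X1 s h1, X2 τ h, ← add_assoc, ← H₁.primitive m ⟨h1, le_rfl⟩, H₁.right, ← H₂.left]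
      exact H₂.primitive τ ⟨h.le, hτ.2⟩
  · rcases lt_trichotomy τ m with h | rfl | h
    · rw [X1 τ h.le]; exact H₁.mem_carrier τ ⟨hτ.1, h⟩
    · rw [X1 τ le_rfl, H₁.right]; exact hz
    · rw [X2 τ h]; exact H₂.mem_carrier τ ⟨h, hτ.2⟩
  · have : ∀ᵐ τ : ℝ, τ ≠ m := by simp [ae_iff, measure_singleton]
    filter_upwards [H₁.mem_controls, H₂.mem_controls, this] with τ c1 c2 hne hτ
    rcases hne.lt_or_gt with h | h
    · rw [X1 τ h.le, V1 τ h.le]; exact c1 ⟨hτ.1, h⟩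
    · rw [X2 τ h, V2 τ h]; exact c2 ⟨h, hτ.2⟩
  · rcases h2.eq_or_lt with rfl | h2
    · rw [X1 m le_rfl, H₁.right, ← H₂.left, H₂.right]
    · rw [X2 t h2, H₂.right]
  · rw [hunion]; exact hL1.union hL2
  · rw [← intervalIntegral.integral_add_adjacent_intervals
      ((intervalIntegrable_iff_integrableOn_Icc_of_le h1).2 hL1)
      ((intervalIntegrable_iff_integrableOn_Ioc_of_le h2).2 hL2)]
    refine add_le_add (le_of_eq_of_le ?_ ha) (le_of_eq_of_le ?_ hb)
    · refine intervalIntegral.integral_congr fun σ hσ => ?_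
      rw [uIcc_of_le h1] at hσ
      simp only [X1 σ hσ.2, V1 σ hσ.2]
    · rw [intervalIntegral.integral_of_le h2, intervalIntegral.integral_of_le h2]
      exact setIntegral_congr_fun measurableSet_Ioc fun σ hσ => by
        simp only [X2 σ hσ.1, V2 σ hσ.1]

/-- The two legs of an optimal path through the junction point. -/
theorem reach_of_isOptimal (hL : ∀ i, IsTonelli γ (L i)) (hρ : 0 ≤ ρ) (hρ' : 0 ≤ ρ') {E τ₁ τ₂ : ℝ}
    (O : IsOptimal (fun q => L i (-q)) (L j) (restCost L) (t - s) ρ ρ' E τ₁ τ₂) :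
    J.Reach L s (ρ • J.e i) (s + τ₁) 0 (τ₁ * L i (-speed (fun q => L i (-q)) E)) ∧
      J.Reach L (t - τ₂) 0 t (ρ' • J.e j) (τ₂ * L j (speed (L j) E)) ∧
      τ₁ * L i (-speed (fun q => L i (-q)) E) + (t - s - τ₁ - τ₂) * restCost L
        + τ₂ * L j (speed (L j) E)
        = throughCost (fun q => L i (-q)) (L j) (restCost L) (t - s) ρ ρ' := by
  refine ⟨?_, ?_, ?_⟩
  · have := reach_leg J L i (s := s) (t := s + τ₁) (q := -speed (fun q => L i (-q)) E)
      (by linarith [O.nonneg₁]) hρ le_rfl (by rw [O.eq₁]; ring)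
    simpa using this
  · have := reach_leg J L j (s := t - τ₂) (t := t) (q := speed (L j) E)
      (by linarith [O.nonneg₂]) le_rfl hρ' (by rw [O.eq₂]; ring)
    simpa using this
  · rw [O.throughCost_eq (hL i).comp_neg (hL j) (restCost_le_neg L i) (restCost_le L j)]
    exact O.cost_eq (hL i).comp_neg (hL j) (restCost_le_neg L i) (restCost_le L j)

theorem reach_throughCost (hL : ∀ i, IsTonelli γ (L i)) (hst : s < t) (hρ : 0 ≤ ρ) (hρ' : 0 ≤ ρ') :
    J.Reach L s (ρ • J.e i) t (ρ' • J.e j)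
      (throughCost (fun q => L i (-q)) (L j) (restCost L) (t - s) ρ ρ') := by
  obtain ⟨E, τ₁, τ₂, O⟩ := exists_isOptimal (hL i).comp_neg (hL j) (restCost_le_neg L i)
    (restCost_le L j) (sub_pos.2 hst) hρ hρ'
  obtain ⟨H₁, H₂, e⟩ := reach_of_isOptimal (J := J) hL hρ hρ' O
  have h1 := O.nonneg₁
  have h2 := O.nonneg₂
  have h3 := O.add_le
  have h0 : (0 : Plane) ∈ J.carrier := branch_subset_carrier i (zero_mem_branch i)
  have R := (H₁.trans (by linarith) (by linarith) h0
    (reach_rest J L (show s + τ₁ ≤ t - τ₂ by linarith))).trans (by linarith) (by linarith) h0 H₂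
  refine R.mono (le_of_eq ?_)
  rw [← e]; ring

theorem reach_branchCost (hL : ∀ i, IsTonelli γ (L i)) (hst : s < t) (hρ : 0 ≤ ρ) (hρ' : 0 ≤ ρ') :
    J.Reach L s (ρ • J.e i) t (ρ' • J.e j) (branchCost L i j (t - s) ρ ρ') := by
  unfold branchCost
  split_ifs with hij
  · subst hij
    rcases min_choice ((t - s) * L i ((ρ' - ρ) / (t - s)))
      (throughCost (fun q => L i (-q)) (L i) (restCost L) (t - s) ρ ρ') with h | h
    · rw [h]
      exact reach_leg J L i hst.le hρ hρ' (div_mul_cancel₀ _ (sub_pos.2 hst).ne').symm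
    · rw [h]
      exact reach_throughCost hL hst hρ hρ'
  · exact reach_throughCost hL hst hρ hρ'

theorem Reach.minAction_le (hst : s < t) (H : J.Reach L s y t x a) :
    J.minAction L s y t x ≤ (a : EReal) := by
  obtain ⟨X, V, H, hI, ha⟩ := H
  rw [minAction, if_pos hst]
  refine iInf_le_of_le X (iInf_le_of_le V (iInf_le_of_le H ?_))
  rw [action, if_pos hI]
  exact_mod_cast ha

theorem le_minAction (hst : s < t) (h : ∀ b, J.Reach L s y t x b → a ≤ b) :
    (a : EReal) ≤ J.minAction L s y t x := by
  rw [minAction, if_pos hst]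
  refine le_iInf fun X => le_iInf fun V => le_iInf fun H => ?_
  rw [action]
  split_ifs with hI
  · exact_mod_cast h _ ⟨X, V, H, hI, le_rfl⟩
  · exact le_top

/-- The explicit formula for the minimal action. -/
theorem minAction_eq (J : Junction N) (hL : ∀ i, IsTonelli γ (L i)) (i j : Fin N) (hst : s < t)
    (hρ : 0 ≤ ρ) (hρ' : 0 ≤ ρ') :
    J.minAction L s (ρ • J.e i) t (ρ' • J.e j) = (branchCost L i j (t - s) ρ ρ' : ℝ) :=
  le_antisymm ((reach_branchCost hL hst hρ hρ').minAction_le hst)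
    (le_minAction hst fun _ H => H.branchCost_le hL hst hρ hρ')

theorem reach_of_minAction_le (hL : ∀ i, IsTonelli γ (L i)) (hst : s < t) (hy : y ∈ J.carrier)
    (hx : x ∈ J.carrier) (h : J.minAction L s y t x ≤ (a : EReal)) : J.Reach L s y t x a := by
  obtain ⟨i, ρ, hρ, rfl⟩ := exists_eq_smul hy
  obtain ⟨j, ρ', hρ', rfl⟩ := exists_eq_smul hx
  rw [minAction_eq J hL i j hst hρ hρ'] at h
  exact (reach_branchCost hL hst hρ hρ').mono (by exact_mod_cast h)

/-- Reversal of time. -/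
theorem minAction_reverse (J : Junction N) (hL : ∀ i, IsTonelli γ (L i)) (hst : s < t)
    (hy : y ∈ J.carrier) (hx : x ∈ J.carrier) :
    J.minAction (fun k q => L k (-q)) (-t) x (-s) y = J.minAction L s y t x := by
  obtain ⟨i, ρ, hρ, rfl⟩ := exists_eq_smul hy
  obtain ⟨j, ρ', hρ', rfl⟩ := exists_eq_smul hx
  -- The symmetry of `branchCost` replaces any reversal of trajectories.
  rw [minAction_eq J hL i j hst hρ hρ', minAction_eq J (fun i => (hL i).comp_neg) j i
    (neg_lt_neg hst) hρ' hρ, branchCost_neg]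
  congr 2
  ring

end Junction

/-! ### Continuity and lower semi-continuity. -/

namespace Junction

variable {N : ℕ} {J : Junction N} {i j k : Fin N} {s t : ℝ} {x y z : Plane}
  {γ : ℝ} {L : Fin N → ℝ → ℝ} {a b m q ρ ρ' : ℝ}

theorem continuousOn_branchCost (hL : ∀ i, IsTonelli γ (L i)) (i j : Fin N) :
    ContinuousOn (fun z : ℝ × ℝ × ℝ => branchCost L i j z.1 z.2.1 z.2.2)
      {z | 0 < z.1 ∧ 0 ≤ z.2.1 ∧ 0 ≤ z.2.2} := by
  have h1 := continuousOn_throughCost (hL i).comp_neg (hL j) (restCost_le_neg L i)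
    (restCost_le L j)
  unfold branchCost
  split_ifs
  · refine ContinuousOn.inf ?_ h1
    refine continuousOn_fst.mul ((hL i).continuous.comp_continuousOn ?_)
    refine ContinuousOn.div (by fun_prop) continuousOn_fst fun z hz => hz.1.ne'
  · exact h1

variable [NeZero N]

theorem minAction_ne_bot_ne_top (hL : ∀ i, IsTonelli γ (L i)) (hst : s < t)
    (hy : y ∈ J.carrier) (hx : x ∈ J.carrier) :
    J.minAction L s y t x ≠ ⊥ ∧ J.minAction L s y t x ≠ ⊤ := by
  obtain ⟨i, ρ, hρ, rfl⟩ := exists_eq_smul hy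
  obtain ⟨j, ρ', hρ', rfl⟩ := exists_eq_smul hx
  rw [minAction_eq J hL i j hst hρ hρ']
  exact ⟨EReal.coe_ne_bot _, EReal.coe_ne_top _⟩

/-- The domain is covered by finitely many relatively closed pieces, one per pair of branches. On
each the formula is continuous in the norms, and a point outside a piece is not in its closure. -/
theorem continuousOn_minAction (J : Junction N) (hL : ∀ i, IsTonelli γ (L i)) :
    ContinuousOn (fun z : (ℝ × Plane) × (ℝ × Plane) => J.minAction L z.1.1 z.1.2 z.2.1 z.2.2)
      {z | z.1.1 < z.2.1 ∧ z.1.2 ∈ J.carrier ∧ z.2.2 ∈ J.carrier} := by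
  set S : Set ((ℝ × Plane) × (ℝ × Plane)) :=
    {z | z.1.1 < z.2.1 ∧ z.1.2 ∈ J.carrier ∧ z.2.2 ∈ J.carrier} with hS
  set B : Fin N × Fin N → Set ((ℝ × Plane) × (ℝ × Plane)) :=
    fun p => {z | z.1.2 ∈ J.branch p.1 ∧ z.2.2 ∈ J.branch p.2}
  have hB : ∀ p, IsClosed (B p) := fun p =>
    ((J.isClosed_branch p.1).preimage (by fun_prop)).inter
      ((J.isClosed_branch p.2).preimage (by fun_prop))
  have hSB : S ⊆ ⋃ p, S ∩ B p := by
    intro z hz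
    obtain ⟨i, hi⟩ := mem_iUnion.1 hz.2.1
    obtain ⟨j, hj⟩ := mem_iUnion.1 hz.2.2
    exact mem_iUnion.2 ⟨(i, j), hz, hi, hj⟩
  intro z hz
  refine ContinuousWithinAt.mono ?_ hSB
  rw [ContinuousWithinAt, nhdsWithin_iUnion, Filter.tendsto_iSup]
  rintro ⟨i, j⟩
  by_cases hzB : z ∈ B (i, j)
  · have hc : ContinuousOn (fun z : (ℝ × Plane) × (ℝ × Plane) =>
        ((branchCost L i j (z.2.1 - z.1.1) ‖z.1.2‖ ‖z.2.2‖ : ℝ) : EReal)) S := by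
      refine continuous_coe_real_ereal.comp_continuousOn ?_
      exact (continuousOn_branchCost hL i j).comp
        (f := fun z : (ℝ × Plane) × (ℝ × Plane) => (z.2.1 - z.1.1, ‖z.1.2‖, ‖z.2.2‖))
        (by fun_prop) fun z hz => ⟨sub_pos.2 hz.1, norm_nonneg _, norm_nonneg _⟩
    refine (((hc z hz).mono inter_subset_left).congr (fun w hw => ?_) ?_ :
      ContinuousWithinAt _ (S ∩ B (i, j)) z)
    · rw [← minAction_eq J hL i j hw.1.1 (norm_nonneg _) (norm_nonneg _),
        ← mem_branch_iff.1 hw.2.1, ← mem_branch_iff.1 hw.2.2]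
    · rw [← minAction_eq J hL i j hz.1 (norm_nonneg _) (norm_nonneg _),
        ← mem_branch_iff.1 hzB.1, ← mem_branch_iff.1 hzB.2]
  · have : 𝓝[S ∩ B (i, j)] z = ⊥ := by
      rw [← notMem_closure_iff_nhdsWithin_eq_bot]
      intro h
      exact hzB ((hB (i, j)).closure_subset (closure_mono inter_subset_right h))
    rw [this]
    exact Filter.tendsto_bot

theorem exists_forall_of_monotone {ι : Type*} [Finite ι] {P : ι → ℝ → Prop}
    (hmono : ∀ i a b, a ≤ b → P i a → P i b) (h : ∀ i, ∃ a, P i a) : ∃ a, ∀ i, P i a := by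
  choose a ha using h
  obtain ⟨C, hC⟩ := (Set.finite_range a).bddAbove
  exact ⟨C, fun i => hmono i _ _ (hC ⟨i, rfl⟩) (ha i)⟩

theorem exists_linear_le_lagrangian (J : Junction N) (hL : ∀ i, IsTonelli γ (L i)) (k : ℝ) :
    ∃ C, ∀ x P, P ∈ J.controls x → k * ‖P‖ - C ≤ J.lagrangian L x P := by
  obtain ⟨C, hC⟩ := exists_forall_of_monotone (P := fun i C => ∀ q, k * |q| - C ≤ L i q)
    (fun i a b hab h q => by linarith [h q]) fun i => ⟨_, (hL i).linear_le k⟩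
  refine ⟨C, ?_⟩
  rintro x P (⟨i, hx, p, rfl⟩ | ⟨rfl, i, p, hp, rfl⟩)
  · obtain ⟨⟨r, hr, rfl⟩, h0⟩ := hx
    have hr0 : 0 < r := hr.lt_of_ne (by rintro rfl; simp at h0)
    rw [lagrangian_smul L hr0, inner_smul_e, norm_smul, J.unit, mul_one]
    exact hC i p
  · rw [lagrangian, if_pos rfl]
    refine le_ciInf fun l => ?_
    have := hC l ‖p • J.e i‖
    rwa [abs_norm] at this

/-- Superlinear growth gives `L ≥ k |q| - C` for every `k`; integration bounds the length of the
path, hence its displacement. -/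
theorem exists_linear_le_minAction (J : Junction N) (hL : ∀ i, IsTonelli γ (L i)) (k : ℝ)
    (hk : 0 ≤ k) :
    ∃ C, ∀ s t y x, s ≤ t →
      ((k * ‖x - y‖ - C * (t - s) : ℝ) : EReal) ≤ J.minAction L s y t x := by
  obtain ⟨C, hC⟩ := J.exists_linear_le_lagrangian hL k
  refine ⟨C, fun s t y x hst => ?_⟩
  rcases hst.eq_or_lt with rfl | hst
  · rw [minAction, if_neg (lt_irrefl _)]
    split_ifs with h
    · simp [h.2]
    · exact le_top
  · refine le_minAction hst ?_
    rintro b ⟨X, V, H, hI, hb⟩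
    refine le_trans ?_ hb
    have hV := H.intervalIntegrable hst.le
    have h1 : ‖x - y‖ ≤ ∫ τ in s..t, ‖V τ‖ := by
      rw [← H.left, ← H.right, H.sub_eq ⟨le_rfl, hst.le⟩ ⟨hst.le, le_rfl⟩]
      exact intervalIntegral.norm_integral_le_integral_norm hst.le
    have h2 : ∫ τ in s..t, (k * ‖V τ‖ - C) ≤ ∫ τ in s..t, J.lagrangian L (X τ) (V τ) := by
      refine intervalIntegral.integral_mono_ae_restrict hst.le
        ((hV.norm.const_mul k).sub intervalIntegrable_const)
        ((intervalIntegrable_iff_integrableOn_Icc_of_le hst.le).2 hI) ?_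
      rw [← Measure.restrict_congr_set Ioo_ae_eq_Icc, Filter.EventuallyLE,
        ae_restrict_iff' measurableSet_Ioo]
      filter_upwards [H.mem_controls] with τ h hτ using hC _ _ (h hτ)
    rw [intervalIntegral.integral_sub (hV.norm.const_mul k) intervalIntegrable_const,
      intervalIntegral.integral_const_mul, intervalIntegral.integral_const, smul_eq_mul] at h2
    nlinarith [mul_le_mul_of_nonneg_left h1 hk]

/-- At `s = t` the bound `k ‖x - y‖ - C (t - s)` decides: a large `k` gives the value `+∞` when `x ≠
y`, and `k = 0` gives the value `0` when `x = y`. -/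
theorem lowerSemicontinuousOn_minAction (J : Junction N) (hL : ∀ i, IsTonelli γ (L i)) :
    LowerSemicontinuousOn
      (fun z : (ℝ × Plane) × (ℝ × Plane) => J.minAction L z.1.1 z.1.2 z.2.1 z.2.2)
      {z | z.1.1 ≤ z.2.1 ∧ z.1.2 ∈ J.carrier ∧ z.2.2 ∈ J.carrier} := by
  intro z₀ hz₀ c hc
  rcases hz₀.1.lt_or_eq with h | h
  · have h1 := (J.continuousOn_minAction hL z₀ ⟨h, hz₀.2⟩).eventually_const_lt hc
    have h2 : ∀ᶠ z : (ℝ × Plane) × (ℝ × Plane) in 𝓝 z₀, z.1.1 < z.2.1 :=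
      (isOpen_lt (by fun_prop) (by fun_prop)).mem_nhds h
    rw [eventually_nhdsWithin_iff] at h1 ⊢
    filter_upwards [h1, h2] with z h1 h2 h3 using h1 ⟨h2, h3.2⟩
  · obtain ⟨c', hcc', hc'⟩ := EReal.lt_iff_exists_real_btwn.1 hc
    simp only [minAction, h, lt_irrefl, if_false, true_and] at hc'
    obtain ⟨k, hk0, hk⟩ : ∃ k, 0 ≤ k ∧ c' < k * ‖z₀.2.2 - z₀.1.2‖ := by
      split_ifs at hc' with hxy
      · refine ⟨0, le_rfl, ?_⟩
        rw [zero_mul]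
        exact_mod_cast hc'
      · have hd : 0 < ‖z₀.2.2 - z₀.1.2‖ := norm_pos_iff.2 (sub_ne_zero.2 (Ne.symm hxy))
        refine ⟨(|c'| + 1) / ‖z₀.2.2 - z₀.1.2‖, by positivity, ?_⟩
        rw [div_mul_cancel₀ _ hd.ne']
        linarith [le_abs_self c']
    obtain ⟨C, hC⟩ := J.exists_linear_le_minAction hL k hk0
    have hcont : Continuous fun z : (ℝ × Plane) × (ℝ × Plane) =>
        k * ‖z.2.2 - z.1.2‖ - C * (z.2.1 - z.1.1) := by fun_prop
    have hev := (hcont.tendsto z₀).eventually_const_lt (u := c') (by simpa [h] using hk)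
    filter_upwards [self_mem_nhdsWithin, nhdsWithin_le_nhds hev] with z hz hlt
    exact hcc'.trans ((EReal.coe_lt_coe_iff.2 hlt).trans_le (hC _ _ _ _ hz.1))

end Junction

/-! ### Speed bounds, the last leg, and semi-concavity. -/

namespace Junction

variable {N : ℕ} {J : Junction N} {i j k : Fin N} {s t : ℝ} {x y z : Plane}
  {γ : ℝ} {L : Fin N → ℝ → ℝ} {a b m q ρ ρ' R : ℝ}

theorem geoDist_smul_self (J : Junction N) (i : Fin N) (hρ : 0 ≤ ρ) (hρ' : 0 ≤ ρ') :
    J.geoDist (ρ • J.e i) (ρ' • J.e i) = |ρ - ρ'| := by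
  rw [geoDist, if_pos ⟨i, smul_mem_branch i hρ, smul_mem_branch i hρ'⟩, norm_smul_sub_smul_self]

theorem geoDist_smul_of_ne (J : Junction N) (hij : i ≠ j) (hρ : 0 ≤ ρ) (hρ' : 0 ≤ ρ') :
    J.geoDist (ρ • J.e i) (ρ' • J.e j) = ρ + ρ' := by
  rw [geoDist]
  split_ifs with h
  · obtain ⟨k, h1, h2⟩ := h
    rcases hρ.eq_or_lt with rfl | hρ0
    · rw [zero_smul, zero_sub, norm_neg, norm_smul_e j hρ', zero_add]
    rcases hρ'.eq_or_lt with rfl | hρ0'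
    · rw [zero_smul, sub_zero, norm_smul_e i hρ, add_zero]
    exact (hij (((smul_mem_branch_iff hρ0).1 h1).trans ((smul_mem_branch_iff hρ0').1 h2).symm)).elim
  · rw [norm_smul_e i hρ, norm_smul_e j hρ']

theorem geoDist_smul_le (J : Junction N) (i j : Fin N) (hρ : 0 ≤ ρ) (hρ' : 0 ≤ ρ') :
    J.geoDist (ρ • J.e i) (ρ' • J.e j) ≤ ρ + ρ' := by
  by_cases hij : i = j
  · subst hij
    rw [geoDist_smul_self J i hρ hρ', abs_le]
    constructor <;> linarith
  · exact (geoDist_smul_of_ne J hij hρ hρ').le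

theorem geoDist_comm (J : Junction N) (hy : y ∈ J.carrier) (hx : x ∈ J.carrier) :
    J.geoDist y x = J.geoDist x y := by
  obtain ⟨i, ρ, hρ, rfl⟩ := exists_eq_smul hy
  obtain ⟨j, ρ', hρ', rfl⟩ := exists_eq_smul hx
  by_cases hij : i = j
  · subst hij
    rw [geoDist_smul_self J i hρ hρ', geoDist_smul_self J i hρ' hρ, abs_sub_comm]
  · rw [geoDist_smul_of_ne J hij hρ hρ', geoDist_smul_of_ne J (Ne.symm hij) hρ' hρ, add_comm]

/-- `Ē R` and `V R` bound the energies and the speeds of the minimizers between points whose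
distance is at most `R` times the available time. -/
structure IsSpeedBound (J : Junction N) (L : Fin N → ℝ → ℝ) (Ē V : ℝ → ℝ) : Prop where
  energy_le : ∀ R i j h ρ ρ' E τ₁ τ₂, 0 < h → 0 ≤ ρ → 0 ≤ ρ' →
    IsOptimal (fun q => L i (-q)) (L j) (restCost L) h ρ ρ' E τ₁ τ₂ →
    J.geoDist (ρ • J.e i) (ρ' • J.e j) ≤ R * h →
    (i = j → throughCost (fun q => L i (-q)) (L j) (restCost L) h ρ ρ'
      ≤ h * L i ((ρ' - ρ) / h)) → E ≤ Ē R
  speed_le : ∀ R k E, E ≤ Ē R → speed (L k) E ≤ V R ∧ speed (fun q => L k (-q)) E ≤ V R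
  le : ∀ R, R ≤ V R
  pos : ∀ R, 0 < V R

/-- On different branches the distance is `ρ + ρ'`, so the mean speed is at most `R`. On one branch
only `|ρ - ρ'|` is controlled, but the detour costs at most the straight path, hence at most `M h`,
while the dual cost at an energy `E'` with both slopes at least `1` is at least `ρ + ρ' - E' h`.
Thus the mean speed is at most `M + E'`. -/
theorem exists_energy_bound (J : Junction N) (hL : ∀ i, IsTonelli γ (L i)) (R : ℝ) :
    ∃ Ē, ∀ i j h ρ ρ' E τ₁ τ₂, 0 < h → 0 ≤ ρ → 0 ≤ ρ' →
      IsOptimal (fun q => L i (-q)) (L j) (restCost L) h ρ ρ' E τ₁ τ₂ →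
      J.geoDist (ρ • J.e i) (ρ' • J.e j) ≤ R * h →
      (i = j → throughCost (fun q => L i (-q)) (L j) (restCost L) h ρ ρ'
        ≤ h * L i ((ρ' - ρ) / h)) → E ≤ Ē := by
  obtain ⟨E₁, hE₁⟩ := exists_forall_of_monotone
    (P := fun k E₁ => ∀ E ≥ E₁, 1 ≤ maxSlope (L k) E)
    (fun k a b hab h E hE => h E (hab.trans hE)) fun k => (hL k).exists_le_maxSlope 1
  obtain ⟨E₂, hE₂⟩ := exists_forall_of_monotone
    (P := fun k E₁ => ∀ E ≥ E₁, 1 ≤ maxSlope (fun q => L k (-q)) E)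
    (fun k a b hab h E hE => h E (hab.trans hE)) fun k => (hL k).comp_neg.exists_le_maxSlope 1
  obtain ⟨M, hM⟩ := exists_forall_of_monotone
    (P := fun k M => ∀ q ∈ Icc (-R) R, ‖L k q‖ ≤ M)
    (fun k a b hab h q hq => (h q hq).trans hab)
    fun k => isCompact_Icc.exists_bound_of_continuousOn (hL k).continuous.continuousOn
  set E' := max (-restCost L) (max E₁ E₂) with hE'
  set S := max R (M + E') with hS
  obtain ⟨Ē₁, hĒ₁⟩ := exists_forall_of_monotone (P := fun k a => energy (L k) S ≤ a)
    (fun k a b hab h => h.trans hab) fun k => ⟨_, le_rfl⟩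
  obtain ⟨Ē₂, hĒ₂⟩ := exists_forall_of_monotone
    (P := fun k a => energy (fun q => L k (-q)) S ≤ a)
    (fun k a b hab h => h.trans hab) fun k => ⟨_, le_rfl⟩
  refine ⟨max (-restCost L) (max Ē₁ Ē₂), fun i j h ρ ρ' E τ₁ τ₂ hh hρ hρ' O hd hij => ?_⟩
  have key : ρ + ρ' ≤ S * h := by
    by_cases e : i = j
    · subst e
      rw [geoDist_smul_self J i hρ hρ'] at hd
      have h1 := dualCost_le_throughCost (E := E') (hL i).comp_neg (hL i) (restCost_le_neg L i)
        (restCost_le L i) hh hρ hρ' (le_max_left _ _)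
      have h2 : (ρ' - ρ) / h ∈ Icc (-R) R := by
        rw [abs_le] at hd
        constructor
        · rw [le_div_iff₀ hh]; linarith
        · rw [div_le_iff₀ hh]; linarith
      have h3 := mul_le_mul_of_nonneg_left ((le_abs_self _).trans (hM i _ h2)) hh.le
      have h4 := mul_le_mul_of_nonneg_right
        (hE₁ i E' ((le_max_left _ _).trans (le_max_right _ _))) hρ'
      have h5 := mul_le_mul_of_nonneg_right
        (hE₂ i E' ((le_max_right _ _).trans (le_max_right _ _))) hρ
      have h6 := mul_le_mul_of_nonneg_right (le_max_right R (M + E')) hh.le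
      have h7 := hij rfl
      simp only [dualCost] at h1
      linarith
    · rw [geoDist_smul_of_ne J e hρ hρ'] at hd
      exact hd.trans (mul_le_mul_of_nonneg_right (le_max_left _ _) hh.le)
  refine (O.energy_le (hL i).comp_neg (hL j) (restCost_le_neg L i) (restCost_le L j) hh key).trans ?_
  refine max_le_max le_rfl (max_le ?_ ?_)
  · exact (hĒ₂ i).trans (le_max_right _ _)
  · exact (hĒ₁ j).trans (le_max_left _ _)

theorem exists_isSpeedBound (J : Junction N) (hL : ∀ i, IsTonelli γ (L i)) :
    ∃ Ē V, J.IsSpeedBound L Ē V := by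
  choose Ē hĒ using J.exists_energy_bound hL
  have hV : ∀ R, ∃ V, ∀ k, speed (L k) (Ē R) ≤ V ∧ speed (fun q => L k (-q)) (Ē R) ≤ V :=
    fun R => exists_forall_of_monotone
      (P := fun k a => speed (L k) (Ē R) ≤ a ∧ speed (fun q => L k (-q)) (Ē R) ≤ a)
      (fun k a b hab h => ⟨h.1.trans hab, h.2.trans hab⟩)
      fun k => ⟨_, le_max_left _ _, le_max_right _ _⟩
  choose V hV using hV
  refine ⟨Ē, fun R => max (V R) (max R 1), hĒ, fun R k E hE => ⟨?_, ?_⟩, fun R => ?_, fun R => ?_⟩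
  · exact (((hL k).strictMono_speed.monotone hE).trans (hV R k).1).trans (le_max_left _ _)
  · exact (((hL k).comp_neg.strictMono_speed.monotone hE).trans (hV R k).2).trans (le_max_left _ _)
  · exact (le_max_left _ _).trans (le_max_right _ _)
  · exact lt_of_lt_of_le one_pos ((le_max_right _ _).trans (le_max_right _ _))

variable [NeZero N]

theorem reach_refl (J : Junction N) (L : Fin N → ℝ → ℝ) (i : Fin N) (s : ℝ) (hρ : 0 ≤ ρ) :
    J.Reach L s (ρ • J.e i) s (ρ • J.e i) 0 := by
  simpa using reach_leg J L i (le_refl s) hρ hρ (q := 0) (by simp)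

/-- A minimizer that ends on an open branch ends with a motion at constant speed `q` that starts
either at the initial time or at the junction point. -/
theorem exists_last_leg {Ē V : ℝ → ℝ} (hL : ∀ i, IsTonelli γ (L i)) (hB : J.IsSpeedBound L Ē V)
    (i j : Fin N) (hst : s < t) (hρ : 0 ≤ ρ) (hρ' : 0 < ρ') :
    ∃ q m c r, s ≤ m ∧ m < t ∧ 0 ≤ r ∧ r ≤ ρ ∧ J.Reach L s (ρ • J.e i) m (r • J.e j) c ∧
      ρ' - r = q * (t - m) ∧ (m = s ∨ r = 0) ∧
      J.minAction L s (ρ • J.e i) t (ρ' • J.e j) = ((c + (t - m) * L j q : ℝ) : EReal) ∧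
      ∀ R, J.geoDist (ρ • J.e i) (ρ' • J.e j) ≤ R * (t - s) → |q| ≤ V R := by
  have hh : 0 < t - s := sub_pos.2 hst
  have hthrough : (i = j → throughCost (fun q => L i (-q)) (L j) (restCost L) (t - s) ρ ρ'
      ≤ (t - s) * L i ((ρ' - ρ) / (t - s))) →
      ∃ q m c r, s ≤ m ∧ m < t ∧ 0 ≤ r ∧ r ≤ ρ ∧ J.Reach L s (ρ • J.e i) m (r • J.e j) c ∧
      ρ' - r = q * (t - m) ∧ (m = s ∨ r = 0) ∧
      branchCost L i j (t - s) ρ ρ' = c + (t - m) * L j q ∧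
      ∀ R, J.geoDist (ρ • J.e i) (ρ' • J.e j) ≤ R * (t - s) → |q| ≤ V R := by
    intro hij
    obtain ⟨E, τ₁, τ₂, O⟩ := exists_isOptimal (hL i).comp_neg (hL j) (restCost_le_neg L i)
      (restCost_le L j) hh hρ hρ'.le
    obtain ⟨H₁, -, e⟩ := reach_of_isOptimal (J := J) hL hρ hρ'.le O
    have h1 := O.nonneg₁
    have h2 := O.nonneg₂
    have h3 := O.add_le
    have hE := O.le_energy
    have hw := (hL j).speed_nonneg (E := E) (by linarith [restCost_le L j])
    have hτ₂ : 0 < τ₂ := h2.lt_of_ne (by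
      rintro rfl
      have := O.eq₂
      linarith)
    -- The last leg starts on leaving the junction point; the incoming leg and the rest go into the
    -- constant `c`.
    refine ⟨speed (L j) E, t - τ₂, τ₁ * L i (-speed (fun q => L i (-q)) E)
      + (t - τ₂ - (s + τ₁)) * restCost L, 0, by linarith, by linarith, le_rfl, hρ, ?_,
      by rw [O.eq₂]; ring, Or.inr rfl, ?_, fun R hR => ?_⟩
    · rw [zero_smul]
      exact H₁.trans (by linarith) (by linarith) (branch_subset_carrier i (zero_mem_branch i))
        (reach_rest J L (by linarith))
    · have hb : branchCost L i j (t - s) ρ ρ'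
          = throughCost (fun q => L i (-q)) (L j) (restCost L) (t - s) ρ ρ' := by
        unfold branchCost
        split_ifs with hc
        · exact min_eq_right (hij hc)
        · rfl
      rw [hb, ← e]; ring
    · rw [abs_of_nonneg hw]
      exact (hB.speed_le R j E (hB.energy_le R i j _ _ _ E τ₁ τ₂ hh hρ hρ'.le O hR hij)).1
  suffices h : ∃ q m c r, s ≤ m ∧ m < t ∧ 0 ≤ r ∧ r ≤ ρ ∧
      J.Reach L s (ρ • J.e i) m (r • J.e j) c ∧ ρ' - r = q * (t - m) ∧ (m = s ∨ r = 0) ∧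
      branchCost L i j (t - s) ρ ρ' = c + (t - m) * L j q ∧
      ∀ R, J.geoDist (ρ • J.e i) (ρ' • J.e j) ≤ R * (t - s) → |q| ≤ V R by
    obtain ⟨q, m, c, r, h1, h2, h3, h4, h5, h6, h7, h8, h9⟩ := h
    exact ⟨q, m, c, r, h1, h2, h3, h4, h5, h6, h7, by
      rw [minAction_eq J hL i j hst hρ hρ'.le, h8], h9⟩
  by_cases hij : i = j
  · subst hij
    rcases le_total ((t - s) * L i ((ρ' - ρ) / (t - s)))
      (throughCost (fun q => L i (-q)) (L i) (restCost L) (t - s) ρ ρ') with hle | hle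
    · refine ⟨(ρ' - ρ) / (t - s), s, 0, ρ, le_rfl, hst, hρ, le_rfl, reach_refl J L i s hρ,
        (div_mul_cancel₀ _ hh.ne').symm, Or.inl rfl, ?_, fun R hR => ?_⟩
      · rw [branchCost, if_pos rfl, min_eq_left hle, zero_add]
      · rw [geoDist_smul_self J i hρ hρ'.le, abs_sub_comm] at hR
        rw [abs_div, abs_of_pos hh]
        exact ((div_le_iff₀ hh).2 hR).trans (hB.le R)
    · exact hthrough fun _ => hle
  · exact hthrough fun h => (hij h).elim

/-- Uniform quadratic upper bound of the minimal action as a function of its end point. -/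
theorem exists_quadratic_bound {Ē V : ℝ → ℝ} (hL : ∀ i, IsTonelli γ (L i))
    (hB : J.IsSpeedBound L Ē V) (i j : Fin N) (hρ : 0 ≤ ρ) {tz rz : ℝ} (htz : s < tz)
    (hrz : 0 < rz) :
    ∃ δ > 0, ∃ C, 0 ≤ C ∧ (∀ t, |t - tz| < δ → s < t) ∧ (∀ r, |r - rz| < δ → 0 < r) ∧
      ∀ t₁ r₁, |t₁ - tz| < δ → |r₁ - rz| < δ → ∃ D q : ℝ,
        J.minAction L s (ρ • J.e i) t₁ (r₁ • J.e j) = (D : EReal) ∧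
        (∀ R, J.geoDist (ρ • J.e i) (r₁ • J.e j) ≤ R * (t₁ - s) → |q| ≤ V R) ∧
        ∀ t r, |t - tz| < δ → |r - rz| < δ →
          J.minAction L s (ρ • J.e i) t (r • J.e j) ≤
            ((D - energy (L j) q * (t - t₁) + deriv (L j) q * (r - r₁)
              + C * ((t - t₁) ^ 2 + (r - r₁) ^ 2) : ℝ) : EReal) := by
  set hm := (tz - s) / 2
  have hm0 : 0 < hm := half_pos (sub_pos.2 htz)
  -- For end points within `δ`, the available time exceeds `hm` and the distance is at most `ρ + 2
  -- rz`; so `V₀` bounds all last velocities.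
  set R₀ := (ρ + 2 * rz) / hm
  set V₀ := V R₀
  have hV₀ : 0 < V₀ := hB.pos R₀
  set η := min hm (rz / 2 / V₀) / 2
  have hη : 0 < η := by positivity
  set Q := max V₀ ((2 * rz + ρ) / η)
  obtain ⟨C, hC0, hC⟩ := (hL j).exists_perspective_le Q hη
  set δ := min (min hm (rz / 2)) (η / 2)
  have hδ : 0 < δ := by positivity
  have d1 : δ ≤ hm := (min_le_left _ _).trans (min_le_left _ _)
  have d2 : δ ≤ rz / 2 := (min_le_left _ _).trans (min_le_right _ _)
  have d3 : δ ≤ η / 2 := min_le_right _ _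
  have hm2 : 2 * hm = tz - s := by simp only [hm]; ring
  have ht : ∀ t, |t - tz| < δ → hm < t - s := fun t h => by
    have := (abs_lt.1 h).1
    linarith
  have hr : ∀ r, |r - rz| < δ → rz / 2 < r ∧ r < 2 * rz := fun r h => by
    have := abs_lt.1 h
    constructor <;> linarith
  refine ⟨δ, hδ, C, hC0, fun t h => by linarith [ht t h], fun r h => by linarith [(hr r h).1],
    fun t₁ r₁ ht₁ hr₁ => ?_⟩
  obtain ⟨q, m, c, r₀, h1, h2, h3, h4, h5, h6, h7, h8, h9⟩ :=
    exists_last_leg hL hB i j (s := s) (t := t₁) (by linarith [ht t₁ ht₁]) hρ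
      (ρ' := r₁) (by linarith [(hr r₁ hr₁).1])
  have hq : |q| ≤ V₀ := by
    refine h9 R₀ ((geoDist_smul_le J i j hρ (by linarith [(hr r₁ hr₁).1])).trans ?_)
    have : R₀ * hm = ρ + 2 * rz := div_mul_cancel₀ _ hm0.ne'
    have hR₀ : 0 ≤ R₀ := by positivity
    have := mul_le_mul_of_nonneg_left (ht t₁ ht₁).le hR₀
    linarith [(hr r₁ hr₁).2]
  -- The last leg either fills the whole time, or covers more than `rz / 2` at speed at most `V₀`.
  have hlen : 2 * η ≤ t₁ - m := by
    have e : 2 * η = min hm (rz / 2 / V₀) := by simp only [η]; ring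
    rw [e]
    rcases h7 with h7 | h7
    · rw [h7]
      exact (min_le_left _ _).trans (ht t₁ ht₁).le
    · refine (min_le_right _ _).trans ?_
      rw [div_le_iff₀ hV₀]
      have : q * (t₁ - m) ≤ V₀ * (t₁ - m) :=
        mul_le_mul_of_nonneg_right ((le_abs_self q).trans hq) (by linarith)
      rw [← h6, h7] at this
      linarith [(hr r₁ hr₁).1]
  refine ⟨_, q, h8, h9, fun t r ht' hr' => ?_⟩
  have htm : η ≤ t - m := by
    have a1 := (abs_lt.1 ht').1
    have a2 := (abs_lt.1 ht₁).2
    linarith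
  have hr0 := hr r hr'
  have htm0 : 0 < t - m := hη.trans_le htm
  -- Competitor: the minimizer for `(t₁, r₁)` up to time `m`, then a straight leg to the new end
  -- point `(t, r)`.
  have hleg := reach_leg J L j (s := m) (t := t) (q := (r - r₀) / (t - m)) (by linarith) h3
    (ρ' := r) (by linarith) (div_mul_cancel₀ _ htm0.ne').symm
  have hreach := h5.trans h1 (by linarith) (smul_mem_carrier j h3) hleg
  refine (hreach.minAction_le (by linarith [ht t ht'])).trans (EReal.coe_le_coe_iff.2 ?_)
  have hqQ : q ∈ Icc (-Q) Q := abs_le.1 (hq.trans (le_max_left _ _))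
  have hq' : (r - r₀) / (t - m) ∈ Icc (-Q) Q := by
    rw [mem_Icc, ← abs_le, abs_div, abs_of_pos htm0]
    refine (div_le_div₀ (by positivity) ?_ hη htm).trans (le_max_right _ _)
    rw [abs_le]
    constructor <;> linarith
  have := hC q hqQ (t₁ - m) (t - m) (r - r₀) (r₁ - r₀) htm hq' h6
  have e1 : t - m - (t₁ - m) = t - t₁ := by ring
  have e2 : r - r₀ - (r₁ - r₀) = r - r₁ := by ring
  rw [e1, e2] at this
  linarith

/-- Subtracting `C |w|²` turns touching paraboloids of common curvature into affine functions
touching from above at every point, which gives concavity. -/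
theorem concaveOn_sub_of_quadratic_bound {S : Set (ℝ × ℝ)} (hS : Convex ℝ S) {f : ℝ × ℝ → ℝ} {C : ℝ}
    (h : ∀ z ∈ S, ∃ a b : ℝ, ∀ w ∈ S, f w ≤ f z + a * (w.1 - z.1) + b * (w.2 - z.2)
      + C * ((w.1 - z.1) ^ 2 + (w.2 - z.2) ^ 2)) :
    ConcaveOn ℝ S (fun w => f w - C * (w.1 ^ 2 + w.2 ^ 2)) := by
  refine ⟨hS, fun u hu v hv α β hα hβ hαβ => ?_⟩
  obtain ⟨a, b, hab⟩ := h _ (hS hu hv hα hβ hαβ)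
  have h1 := mul_le_mul_of_nonneg_left (hab u hu) hα
  have h2 := mul_le_mul_of_nonneg_left (hab v hv) hβ
  simp only [Prod.fst_add, Prod.snd_add, Prod.smul_fst, Prod.smul_snd, smul_eq_mul] at h1 h2 ⊢
  have hβ' : β = 1 - α := by linarith
  subst hβ'
  nlinarith

theorem locallySemiconcaveOn_minAction_right (J : Junction N) (hL : ∀ i, IsTonelli γ (L i))
    (s : ℝ) (hy : y ∈ J.carrier) (j : Fin N) :
    LocallySemiconcaveOn (fun z => (J.minAction L s y z.1 (z.2 • J.e j)).toReal)
      (Ioi s ×ˢ Ioi 0) := by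
  obtain ⟨i, ρ, hρ, rfl⟩ := exists_eq_smul hy
  obtain ⟨Ē, V, hB⟩ := J.exists_isSpeedBound hL
  rintro ⟨tz, rz⟩ ⟨htz, hrz⟩
  obtain ⟨δ, hδ, C, -, ht, hr, H⟩ := exists_quadratic_bound hL hB i j hρ htz hrz
  have hmem : ∀ z ∈ Metric.ball (tz, rz) δ, |z.1 - tz| < δ ∧ |z.2 - rz| < δ := fun z hz => by
    rw [Metric.mem_ball, Prod.dist_eq, max_lt_iff, Real.dist_eq, Real.dist_eq] at hz
    exact hz
  refine ⟨δ, hδ, C, fun z hz => ⟨ht _ (hmem z hz).1, hr _ (hmem z hz).2⟩, ?_⟩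
  refine concaveOn_sub_of_quadratic_bound (convex_ball _ _) fun z hz => ?_
  obtain ⟨D, q, hD, -, h⟩ := H z.1 z.2 (hmem z hz).1 (hmem z hz).2
  refine ⟨-energy (L j) q, deriv (L j) q, fun w hw => ?_⟩
  have h1 := h w.1 w.2 (hmem w hw).1 (hmem w hw).2
  have hne := minAction_ne_bot_ne_top (J := J) hL (ht _ (hmem w hw).1) hy
    (smul_mem_carrier j (hr _ (hmem w hw).2).le)
  rw [hD, EReal.toReal_coe]
  have h2 := EReal.toReal_le_toReal h1 hne.1 (EReal.coe_ne_top _)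
  rw [EReal.toReal_coe] at h2
  linarith

theorem locallySemiconcaveOn_minAction_left (J : Junction N) (hL : ∀ i, IsTonelli γ (L i))
    (t : ℝ) (hx : x ∈ J.carrier) (j : Fin N) :
    LocallySemiconcaveOn (fun z => (J.minAction L z.1 (z.2 • J.e j) t x).toReal)
      (Ioo 0 t ×ˢ Ioi 0) := by
  rintro ⟨sz, rz⟩ ⟨hsz, hrz⟩
  obtain ⟨ρ, hρ, C, hsub, hconc⟩ := J.locallySemiconcaveOn_minAction_right
    (L := fun k q => L k (-q)) (fun i => (hL i).comp_neg) (-t) hx j (-sz, rz)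
    ⟨neg_lt_neg hsz.2, hrz⟩
  -- The radius `sz` keeps the starting times positive.
  have hρ' : 0 < min ρ sz := lt_min hρ hsz.1
  have hmem : ∀ z ∈ Metric.ball (sz, rz) (min ρ sz), 0 < z.1 ∧
      ((-z.1, z.2) : ℝ × ℝ) ∈ Metric.ball (-sz, rz) ρ := fun z hz => by
    rw [Metric.mem_ball, Prod.dist_eq, max_lt_iff, Real.dist_eq, Real.dist_eq] at hz
    rw [Metric.mem_ball, Prod.dist_eq, max_lt_iff, Real.dist_eq, Real.dist_eq]
    refine ⟨by linarith [(abs_lt.1 (hz.1.trans_le (min_le_right _ _))).1], ?_,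
      hz.2.trans_le (min_le_left _ _)⟩
    have e : -z.1 - -sz = -(z.1 - sz) := by ring
    rw [e, abs_neg]
    exact hz.1.trans_le (min_le_left _ _)
  have hU : ∀ z ∈ Metric.ball (sz, rz) (min ρ sz), z ∈ Ioo 0 t ×ˢ Ioi (0 : ℝ) := fun z hz => by
    have h := hsub (hmem z hz).2
    exact ⟨⟨(hmem z hz).1, neg_lt_neg_iff.1 h.1⟩, h.2⟩
  refine ⟨min ρ sz, hρ', C, hU, ?_⟩
  have hcomp := hconc.comp_linearMap
    ((-LinearMap.id : ℝ →ₗ[ℝ] ℝ).prodMap (LinearMap.id : ℝ →ₗ[ℝ] ℝ))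
  refine ((hcomp.subset (fun z hz => (hmem z hz).2) (convex_ball _ _)).congr fun z hz => ?_)
  have h := hU z hz
  have := minAction_reverse J hL h.1.2 (smul_mem_carrier j (mem_Ioi.1 h.2).le) hx
  simp [this]

end Junction

/-! ### Hamiltonians, test functions, and end points at the junction point. -/

theorem energy_comp_neg (Λ : ℝ → ℝ) (q : ℝ) : energy (fun q => Λ (-q)) q = energy Λ (-q) := by
  rw [energy, energy, IsTonelli.deriv_comp_neg]; ring

namespace IsTonelli

open Junction

variable {γ : ℝ} {Λ : ℝ → ℝ}

theorem legendre_deriv (h : IsTonelli γ Λ) (q : ℝ) : legendre Λ (deriv Λ q) = energy Λ q := by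
  have hg : IsGreatest (range fun q' : ℝ => deriv Λ q * q' - Λ q') (energy Λ q) := by
    refine ⟨⟨q, by simp only [energy]; ring⟩, ?_⟩
    rintro _ ⟨q', rfl⟩
    have := h.tangent_le q q'
    simp only [energy]
    linarith
  exact hg.csSup_eq

theorem legendreNeg_deriv (h : IsTonelli γ Λ) {q : ℝ} (hq : q ≤ 0) :
    legendreNeg Λ (deriv Λ q) = energy Λ q := by
  have hg : IsGreatest (range fun q' : Iic (0 : ℝ) => deriv Λ q * q' - Λ q') (energy Λ q) := by
    refine ⟨⟨⟨q, hq⟩, by simp only [energy]; ring⟩, ?_⟩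
    rintro _ ⟨q', rfl⟩
    have := h.tangent_le q q'
    simp only [energy]
    linarith
  exact hg.csSup_eq

theorem neg_le_legendreNeg (h : IsTonelli γ Λ) (p : ℝ) : -Λ 0 ≤ legendreNeg Λ p := by
  have hb : BddAbove (range fun q : Iic (0 : ℝ) => p * q - Λ q) := by
    refine ⟨-Λ 0 + (|p| + |deriv Λ 0|) ^ 2 / (2 * γ), ?_⟩
    rintro _ ⟨q, rfl⟩
    have h1 := h.linear_le |p| q
    have h2 : p * q ≤ |p| * |(q : ℝ)| := by rw [← abs_mul]; exact le_abs_self _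
    simp only
    linarith
  have := le_ciSup hb ⟨0, self_mem_Iic⟩
  simpa [legendreNeg] using this

end IsTonelli

namespace Junction

variable {N : ℕ} {J : Junction N} {i j k : Fin N} {s t : ℝ} {x y z : Plane}
  {γ : ℝ} {L : Fin N → ℝ → ℝ} {a b c m q ρ ρ' R : ℝ}

/-- A function on the junction that is affine along each branch up to a second-order term in time
and a term `Θ(|x|)` in space. -/
def testFun (J : Junction N) (c a t₀ : ℝ) (b : Fin N → ℝ) (C : ℝ) (Θ : ℝ → ℝ) (t : ℝ) (x : Plane) :
    ℝ :=
  c + a * (t - t₀) + ∑ k, b k * J.coord k x + C * ((t - t₀) ^ 2 + Θ ‖x‖)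

theorem testFun_smul (J : Junction N) (c a t₀ : ℝ) (b : Fin N → ℝ) (C : ℝ) (Θ : ℝ → ℝ) (t : ℝ)
    (k : Fin N) (hρ : 0 ≤ ρ) :
    J.testFun c a t₀ b C Θ t (ρ • J.e k)
      = c + a * (t - t₀) + b k * ρ + C * ((t - t₀) ^ 2 + Θ ρ) := by
  rw [testFun, sum_mul_coord_smul b k hρ, norm_smul_e k hρ]

theorem isC1Star_testFun (J : Junction N) (T c a t₀ : ℝ) (b : Fin N → ℝ) (C : ℝ) {Θ : ℝ → ℝ}
    (hΘ : ContDiff ℝ 1 Θ) : J.IsC1Star T (J.testFun c a t₀ b C Θ) := by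
  have hΘc := hΘ.continuous
  refine ⟨?_, fun k => ?_⟩
  · have hsum : ContinuousOn (fun z : ℝ × Plane => ∑ k, b k * J.coord k z.2)
        (Ioo 0 T ×ˢ J.carrier) :=
      continuousOn_finsetSum _ fun k _ => continuousOn_const.mul
        ((J.continuousOn_coord k).comp continuousOn_snd fun z hz => hz.2)
    have h1 : Continuous fun z : ℝ × Plane => c + a * (z.1 - t₀) := by fun_prop
    have h2 : Continuous fun z : ℝ × Plane => C * ((z.1 - t₀) ^ 2 + Θ ‖z.2‖) := by fun_prop
    exact (h1.continuousOn.add hsum).add h2.continuousOn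
  · have h : ContDiff ℝ 1 fun z : ℝ × ℝ =>
        c + a * (z.1 - t₀) + b k * z.2 + C * ((z.1 - t₀) ^ 2 + Θ z.2) := by fun_prop
    exact h.contDiffOn.congr fun z hz => testFun_smul J c a t₀ b C Θ z.1 k hz.2

theorem deriv_testFun (J : Junction N) (c a t₀ : ℝ) (b : Fin N → ℝ) (C : ℝ) (Θ : ℝ → ℝ)
    (x : Plane) : deriv (fun t => J.testFun c a t₀ b C Θ t x) t₀ = a := by
  have h : HasDerivAt (fun t : ℝ => t - t₀) 1 t₀ := (hasDerivAt_id' t₀).sub_const t₀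
  have := (((h.const_mul a).const_add c).add_const (∑ k, b k * J.coord k x)).add
    (((h.fun_pow 2).add_const (Θ ‖x‖)).const_mul C)
  refine (this.congr_deriv ?_).deriv
  simp

theorem spaceDeriv_testFun (J : Junction N) (c a t₀ : ℝ) (b : Fin N → ℝ) (C : ℝ) {Θ : ℝ → ℝ}
    {x : Plane} (hΘ : HasDerivAt Θ 0 ‖x‖) :
    J.spaceDeriv (J.testFun c a t₀ b C Θ t₀) x = b := by
  ext k
  have h1 : HasDerivAt (fun r : ℝ => c + a * (t₀ - t₀) + b k * r + C * ((t₀ - t₀) ^ 2 + Θ r))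
      (b k) ‖x‖ := by
    have := (((hasDerivAt_id' ‖x‖).const_mul (b k)).const_add (c + a * (t₀ - t₀))).fun_add
      ((hΘ.const_add ((t₀ - t₀) ^ 2)).const_mul C)
    exact this.congr_deriv (by simp)
  have h2 : HasDerivWithinAt (fun r : ℝ => J.testFun c a t₀ b C Θ t₀ (r • J.e k)) (b k)
      (Ici 0) ‖x‖ :=
    h1.hasDerivWithinAt.congr (fun r hr => testFun_smul J c a t₀ b C Θ t₀ k hr)
      (testFun_smul J c a t₀ b C Θ t₀ k (norm_nonneg x))
  exact h2.derivWithin (uniqueDiffOn_Ici 0 _ (norm_nonneg x))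

/-- Calibrating the straight path to `0` bounds every dual cost. So at the junction point
`branchCost` is the through cost, and `IsOptimal` describes the minimizer. -/
theorem throughCost_le_straight (hL : ∀ i, IsTonelli γ (L i)) (i : Fin N) {h : ℝ} (hh : 0 < h) :
    throughCost (fun q => L i (-q)) (L j) (restCost L) h ρ 0 ≤ h * L i ((0 - ρ) / h) := by
  have : Nonempty (Ici (-restCost L)) := ⟨⟨_, self_mem_Ici⟩⟩
  refine ciSup_le fun E => ?_
  have hE : -restCost L ≤ (E : ℝ) := E.2
  have h1 := mul_le_mul_of_nonneg_left ((hL i).comp_neg.maxSlope_mul_sub_le (E := E)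
    (by linarith [restCost_le_neg L i]) (ρ / h)) hh.le
  have h2 : h * (ρ / h) = ρ := by field_simp
  have h3 : -(ρ / h) = (0 - ρ) / h := by ring
  simp only [h3] at h1
  refine le_trans (le_of_eq ?_) h1
  simp only [dualCost]
  linear_combination (-maxSlope (fun q => L i (-q)) (E : ℝ)) * h2

variable [NeZero N]

theorem gradAbs_le (J : Junction N) (x : Plane) {p : Fin N → ℝ} {B : ℝ} (hp : ∀ k, |p k| ≤ B) :
    J.gradAbs x p ≤ N * B := by
  have hB : 0 ≤ B := (abs_nonneg _).trans (hp 0)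
  unfold gradAbs
  split_ifs
  · have h1 : ∑ k, p k ^ 2 ≤ (N * B) ^ 2 := by
      calc ∑ k, p k ^ 2 ≤ ∑ _k : Fin N, B ^ 2 :=
            Finset.sum_le_sum fun k _ => sq_le_sq' (abs_le.1 (hp k)).1 (abs_le.1 (hp k)).2
        _ = N * B ^ 2 := by simp
        _ ≤ (N * B) ^ 2 := by
          have : (1 : ℝ) ≤ N := by exact_mod_cast NeZero.one_le
          rw [mul_pow, sq (N : ℝ), mul_assoc]
          exact le_mul_of_one_le_left (by positivity) this
    exact (Real.sqrt_le_sqrt h1).trans_eq (Real.sqrt_sq (by positivity))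
  · have : (1 : ℝ) ≤ N := by exact_mod_cast NeZero.one_le
    exact (hp _).trans (le_mul_of_one_le_left hB this)

theorem hamiltonian_smul (J : Junction N) (L : Fin N → ℝ → ℝ) (hρ : 0 < ρ) (p : Fin N → ℝ) :
    J.hamiltonian L (ρ • J.e k) p = legendre (L k) (p k) := by
  rw [hamiltonian, if_neg (smul_e_ne_zero k hρ), index_smul hρ]

/-- Quadratic upper bound of the minimal action near an end point `(t₀, 0)`. -/
theorem exists_quadratic_bound_zero {Ē V : ℝ → ℝ} (hL : ∀ i, IsTonelli γ (L i))
    (hB : J.IsSpeedBound L Ē V) (i : Fin N) (hρ : 0 ≤ ρ) {t₀ : ℝ} (hst : s < t₀) :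
    ∃ E D δ C : ℝ, -restCost L ≤ E ∧ 0 < δ ∧ 0 ≤ C ∧
      J.minAction L s (ρ • J.e i) t₀ 0 = (D : EReal) ∧
      (∀ R, J.geoDist (ρ • J.e i) 0 ≤ R * (t₀ - s) → E ≤ Ē R) ∧
      (∀ t, |t - t₀| < δ → s < t ∧ J.minAction L s (ρ • J.e i) t 0 ≤
        ((D - E * (t - t₀) + C * (t - t₀) ^ 2 : ℝ) : EReal)) ∧
      (E = -restCost L ∨ ∀ t r, |t - t₀| < δ → 0 ≤ r → r < δ →
        J.minAction L s (ρ • J.e i) t (r • J.e i) ≤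
          ((D - E * (t - t₀) + deriv (L i) (-speed (fun q => L i (-q)) E) * r
            + C * ((t - t₀) ^ 2 + r ^ 2) : ℝ) : EReal)) := by
  have hh : 0 < t₀ - s := sub_pos.2 hst
  obtain ⟨E, τ₁, τ₂, O⟩ := exists_isOptimal (hL i).comp_neg (hL i) (restCost_le_neg L i)
    (restCost_le L i) hh hρ le_rfl
  obtain ⟨H₁, -, e⟩ := reach_of_isOptimal (J := J) hL hρ le_rfl O
  have hE := O.le_energy
  have h1 := O.nonneg₁
  have h2 := O.nonneg₂
  have h3 := O.add_le
  have hD : J.minAction L s (ρ • J.e i) t₀ 0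
      = ((throughCost (fun q => L i (-q)) (L i) (restCost L) (t₀ - s) ρ 0 : ℝ) : EReal) := by
    have := minAction_eq J hL i i hst hρ le_rfl
    rw [zero_smul, branchCost, if_pos rfl, min_eq_right (throughCost_le_straight hL i hh)] at this
    exact this
  have hR : ∀ R, J.geoDist (ρ • J.e i) 0 ≤ R * (t₀ - s) → E ≤ Ē R := fun R hR =>
    hB.energy_le R i i _ _ _ E τ₁ τ₂ hh hρ le_rfl O (by rwa [zero_smul])
      fun _ => throughCost_le_straight hL i hh
  rcases (show τ₁ ≤ t₀ - s by linarith).lt_or_eq with hlt | heq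
  · have hEr : E = -restCost L := by
      rcases O.rest with h | h
      · exact h
      · by_contra hne
        have hpos := (hL i).speed_pos (E := E) (by
          have := hE.lt_of_ne (Ne.symm hne)
          linarith [restCost_le L i])
        have : 0 < speed (L i) E * τ₂ := mul_pos hpos (by linarith)
        linarith [O.eq₂]
    refine ⟨E, _, t₀ - s - τ₁, 0, hE, by linarith, le_rfl, hD, hR, fun t ht => ?_, Or.inl hEr⟩
    have ht' := (abs_lt.1 ht).1
    refine ⟨by linarith, ?_⟩
    have R := H₁.trans (by linarith) (by linarith) (branch_subset_carrier i (zero_mem_branch i))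
      (reach_rest J L (show s + τ₁ ≤ t by linarith))
    refine (R.minAction_le (by linarith)).trans (EReal.coe_le_coe_iff.2 (le_of_eq ?_))
    rw [← e, (hL i).speed_mul_maxSlope (E := E) (by linarith [restCost_le L i])]
    have := O.eq₂
    rw [hEr] at *
    linear_combination maxSlope (L i) (-restCost L) * this
  · have hτ₂ : τ₂ = 0 := by linarith
    set v := speed (fun q => L i (-q)) E with hv
    have hv0 : 0 ≤ v := (hL i).comp_neg.speed_nonneg (by linarith [restCost_le_neg L i])
    have hDv : throughCost (fun q => L i (-q)) (L i) (restCost L) (t₀ - s) ρ 0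
        = (t₀ - s) * L i (-v) := by
      rw [← e, heq, hτ₂]; ring
    have hEv : energy (L i) (-v) = E := by
      rw [← energy_comp_neg]
      exact (hL i).comp_neg.energy_speed (by linarith [restCost_le_neg L i])
    set η := (t₀ - s) / 2
    have hη : 0 < η := half_pos hh
    have hη2 : 2 * η = t₀ - s := by simp only [η]; ring
    set Q := max v ((η + ρ) / η)
    obtain ⟨C, hC0, hC⟩ := (hL i).exists_perspective_le Q hη
    have key : ∀ t r, |t - t₀| < η → 0 ≤ r → r < η →
        J.minAction L s (ρ • J.e i) t (r • J.e i) ≤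
          (((t₀ - s) * L i (-v) - E * (t - t₀) + deriv (L i) (-v) * r
            + C * ((t - t₀) ^ 2 + r ^ 2) : ℝ) : EReal) := by
      intro t r ht hr0 hr
      have ht' := (abs_lt.1 ht).1
      have hts : η ≤ t - s := by linarith
      have hts0 : 0 < t - s := hη.trans_le hts
      have R := reach_leg J L i (s := s) (t := t) (q := (r - ρ) / (t - s)) (by linarith) hρ hr0
        (div_mul_cancel₀ _ hts0.ne').symm
      refine (R.minAction_le (by linarith)).trans (EReal.coe_le_coe_iff.2 ?_)
      have hq : -v ∈ Icc (-Q) Q := ⟨neg_le_neg (le_max_left _ _),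
        (neg_nonpos.2 hv0).trans (hv0.trans (le_max_left _ _))⟩
      have hq' : (r - ρ) / (t - s) ∈ Icc (-Q) Q := by
        rw [mem_Icc, ← abs_le, abs_div, abs_of_pos hts0]
        refine (div_le_div₀ (by positivity) ?_ hη hts).trans (le_max_right _ _)
        rw [abs_le]
        constructor <;> linarith
      have h := hC (-v) hq (t₀ - s) (t - s) (r - ρ) (-ρ) hts hq' (by rw [O.eq₁, heq]; ring)
      rw [hEv] at h
      have e1 : t - s - (t₀ - s) = t - t₀ := by ring
      have e2 : r - ρ - -ρ = r := by ring
      rwa [e1, e2] at h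
    rw [hDv] at hD
    refine ⟨E, _, η, C, hE, hη, hC0, hD, hR, fun t ht => ⟨?_, ?_⟩, Or.inr key⟩
    · linarith [(abs_lt.1 ht).1]
    · simpa using key t 0 ht le_rfl hη

end Junction

/-! ### Test functions in the end point. -/

namespace Junction

variable {N : ℕ} {J : Junction N} {i j k : Fin N} {s t : ℝ} {x y z : Plane}
  {γ : ℝ} {L : Fin N → ℝ → ℝ} {a b c m q ρ ρ' R : ℝ}

theorem exists_slope_bound (hL : ∀ i, IsTonelli γ (L i)) (Ē V : ℝ → ℝ) :
    ∃ G : ℝ → ℝ, ∀ R, (∀ k q, |q| ≤ V R → |deriv (L k) q| ≤ G R) ∧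
      ∀ k E, -restCost L ≤ E → E ≤ Ē R → |L k 1 + E| ≤ G R := by
  have h : ∀ R, ∃ G, ∀ k, (∀ q, |q| ≤ V R → |deriv (L k) q| ≤ G) ∧
      ∀ E, -restCost L ≤ E → E ≤ Ē R → |L k 1 + E| ≤ G := by
    refine fun R => exists_forall_of_monotone
      (P := fun k G => (∀ q, |q| ≤ V R → |deriv (L k) q| ≤ G) ∧
        ∀ E, -restCost L ≤ E → E ≤ Ē R → |L k 1 + E| ≤ G)
      (fun k a b hab h => ⟨fun q hq => (h.1 q hq).trans hab,
        fun E h1 h2 => (h.2 E h1 h2).trans hab⟩) fun k => ?_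
    obtain ⟨G₁, hG₁⟩ := isCompact_Icc.exists_bound_of_continuousOn (s := Icc (-V R) (V R))
      (hL k).continuous_deriv.continuousOn
    obtain ⟨G₂, hG₂⟩ := isCompact_Icc.exists_bound_of_continuousOn (s := Icc (-restCost L) (Ē R))
      (f := fun E => L k 1 + E) (by fun_prop)
    exact ⟨max G₁ G₂, fun q hq => (hG₁ q (abs_le.1 hq)).trans (le_max_left _ _),
      fun E h1 h2 => (hG₂ E ⟨h1, h2⟩).trans (le_max_right _ _)⟩
  choose G hG using h
  exact ⟨G, fun R => ⟨fun k => (hG R k).1, fun k => (hG R k).2⟩⟩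

theorem exists_smul_of_geoDist_lt (hx : x ∈ J.carrier) {r : ℝ} (hρ : 0 ≤ ρ) (hrρ : r ≤ ρ)
    (h : J.geoDist x (ρ • J.e j) < r) : ∃ r', 0 ≤ r' ∧ |r' - ρ| < r ∧ x = r' • J.e j := by
  obtain ⟨k, r', hr', rfl⟩ := exists_eq_smul hx
  by_cases hkj : k = j
  · subst hkj
    rw [geoDist_smul_self J k hr' hρ] at h
    exact ⟨r', hr', h, rfl⟩
  · rw [geoDist_smul_of_ne J hkj hr' hρ] at h
    linarith

theorem exists_smul_of_geoDist_zero_lt (hx : x ∈ J.carrier) {r : ℝ} (h : J.geoDist x 0 < r) :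
    ∃ k r', 0 ≤ r' ∧ r' < r ∧ x = r' • J.e k := by
  obtain ⟨k, r', hr', rfl⟩ := exists_eq_smul hx
  refine ⟨k, r', hr', ?_, rfl⟩
  rw [← zero_smul ℝ (J.e k), geoDist_smul_self J k hr' le_rfl, sub_zero] at h
  exact (le_abs_self _).trans_lt h

theorem zero_mem_carrier [NeZero N] (J : Junction N) : (0 : Plane) ∈ J.carrier :=
  branch_subset_carrier 0 (zero_mem_branch 0)

variable [NeZero N]

/-- Test functions that touch the minimal action from above as a function of its end point. -/
theorem exists_testFun_right (J : Junction N) (hL : ∀ i, IsTonelli γ (L i)) :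
    ∃ C : ℝ → ℝ, ∀ (T s t₀ : ℝ) (y x : Plane), s < t₀ → t₀ < T → y ∈ J.carrier → x ∈ J.carrier →
      ∃ (φ : ℝ → Plane → ℝ) (r : ℝ), J.IsC1Star T φ ∧ 0 < r ∧
        (∀ (t : ℝ), ∀ x' ∈ J.carrier, |t - t₀| < r → J.geoDist x' x < r →
          s < t ∧ t < T ∧ J.minAction L s y t x' ≤ (φ t x' : EReal)) ∧
        J.minAction L s y t₀ x = (φ t₀ x : EReal) ∧
        0 ≤ deriv (fun t => φ t x) t₀ + J.hamiltonian L x (J.spaceDeriv (φ t₀) x) ∧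
        ∀ R, J.geoDist y x ≤ R * (t₀ - s) → J.gradAbs x (J.spaceDeriv (φ t₀) x) ≤ C R := by
  obtain ⟨Ē, V, hB⟩ := J.exists_isSpeedBound hL
  obtain ⟨G, hG⟩ := exists_slope_bound hL Ē V
  refine ⟨fun R => N * G R, fun T s t₀ y x hst htT hy hx => ?_⟩
  obtain ⟨i, ρ, hρ, rfl⟩ := exists_eq_smul hy
  obtain ⟨j, ρ', hρ', rfl⟩ := exists_eq_smul hx
  rcases hρ'.eq_or_lt with rfl | hρ'0
  · rw [zero_smul]
    obtain ⟨E, D, δ, C, hE, hδ, hC, hD, hR, hbound, hbranch⟩ :=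
      exists_quadratic_bound_zero hL hB i hρ hst
    -- The slope `L k 1 + E` comes from reaching `0` at time `t - r` and then moving outwards at
    -- speed `1`. Above the lowest energy, branch `i` instead has the slope of the incoming leg. The
    -- factor `2 * C` below absorbs `(t - t₀ - r)²`.
    set b : Fin N → ℝ := fun k => if E = -restCost L ∨ k ≠ i then L k 1 + E
      else deriv (L i) (-speed (fun q => L i (-q)) E) with hb
    have hΘ : HasDerivAt (fun r : ℝ => r ^ 2) 0 ‖(0 : Plane)‖ := by
      simpa using (hasDerivAt_id' ‖(0 : Plane)‖).fun_pow 2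
    refine ⟨J.testFun D (-E) t₀ b (2 * C) (fun r => r ^ 2), min (δ / 2) (T - t₀),
      isC1Star_testFun J T _ _ _ _ _ (by fun_prop), lt_min (by linarith) (by linarith),
      fun t x' hx' ht hx'r => ?_, ?_, ?_, fun R hR' => ?_⟩
    · obtain ⟨k, r, hr, hrδ, rfl⟩ := exists_smul_of_geoDist_zero_lt hx' hx'r
      have ht1 := ht.trans_le (min_le_left _ _)
      have ht2 := (abs_lt.1 (ht.trans_le (min_le_right _ _))).2
      have hr1 := hrδ.trans_le (min_le_left _ _)
      refine ⟨(hbound t (ht1.trans (half_lt_self hδ))).1, by linarith, ?_⟩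
      rw [testFun_smul J _ _ _ _ _ _ _ k hr]
      by_cases hk : E = -restCost L ∨ k ≠ i
      · have hbk : b k = L k 1 + E := if_pos hk
        have htr : |t - r - t₀| < δ := by
          rw [abs_lt] at ht1 ⊢
          constructor <;> linarith
        obtain ⟨h1, h2⟩ := hbound (t - r) htr
        have hleg := reach_leg J L k (s := t - r) (t := t) (ρ := 0) (ρ' := r) (q := 1)
          (by linarith) le_rfl hr (by ring)
        rw [zero_smul] at hleg
        have hreach := (reach_of_minAction_le hL h1 hy J.zero_mem_carrier h2).trans h1.le
          (by linarith) J.zero_mem_carrier hleg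
        refine (hreach.minAction_le (by linarith)).trans (EReal.coe_le_coe_iff.2 ?_)
        rw [hbk]
        nlinarith [mul_nonneg hC (sq_nonneg (t - t₀ + r))]
      · have hbk : b k = deriv (L i) (-speed (fun q => L i (-q)) E) := if_neg hk
        push Not at hk
        obtain rfl := hk.2
        have h1 := (hbranch.resolve_left hk.1) t r (by linarith) hr (by linarith)
        refine h1.trans (EReal.coe_le_coe_iff.2 ?_)
        rw [hbk]
        nlinarith [mul_nonneg hC (sq_nonneg (t - t₀)), mul_nonneg hC (sq_nonneg r)]
    · rw [hD, ← zero_smul ℝ (J.e i), testFun_smul J _ _ _ _ _ _ _ i le_rfl]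
      simp
    · rw [deriv_testFun, spaceDeriv_testFun J _ _ _ _ _ hΘ, hamiltonian, if_pos rfl]
      have hbdd : BddAbove (range fun k => legendreNeg (L k) (b k)) :=
        (Set.finite_range _).bddAbove
      -- At the lowest energy a branch with minimal `L l 0` suffices, whatever its slope; above it,
      -- branch `i` has reduced Hamiltonian exactly `E`.
      by_cases hEr : E = -restCost L
      · obtain ⟨l, hl⟩ := exists_restCost_eq L
        have h1 := le_ciSup hbdd l
        have h2 := (hL l).neg_le_legendreNeg (b l)
        linarith
      · have h1 := le_ciSup hbdd i
        have hbi : b i = deriv (L i) (-speed (fun q => L i (-q)) E) :=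
          if_neg (by simp [hEr])
        have hv := (hL i).comp_neg.speed_nonneg (E := E) (by linarith [restCost_le_neg L i])
        have he := (hL i).comp_neg.energy_speed (E := E) (by linarith [restCost_le_neg L i])
        rw [energy_comp_neg] at he
        simp only [hbi] at h1
        rw [(hL i).legendreNeg_deriv (by linarith), he] at h1
        linarith
    · rw [spaceDeriv_testFun J _ _ _ _ _ hΘ]
      refine gradAbs_le J _ fun k => ?_
      have hEle := hR R hR'
      simp only [hb]
      split_ifs
      · exact (hG R).2 k E hE hEle
      · refine (hG R).1 i _ ?_
        rw [abs_neg, abs_of_nonneg ((hL i).comp_neg.speed_nonneg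
          (by linarith [restCost_le_neg L i]))]
        exact (hB.speed_le R i E hEle).2
  · obtain ⟨δ, hδ, C, hC, ht, hr, H⟩ := exists_quadratic_bound hL hB i j hρ hst hρ'0
    obtain ⟨D, q, hD, hR, h⟩ := H t₀ ρ' (by simpa using hδ) (by simpa using hδ)
    have hΘ : HasDerivAt (fun r : ℝ => (r - ρ') ^ 2) 0 ‖ρ' • J.e j‖ := by
      rw [norm_smul_e j hρ']
      simpa using ((hasDerivAt_id' ρ').sub_const ρ').fun_pow 2
    -- The radius `ρ'` confines the ball to branch `j`, so the slopes on other branches are free.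
    refine ⟨J.testFun (D - deriv (L j) q * ρ') (-energy (L j) q) t₀ (fun _ => deriv (L j) q) C
      (fun r => (r - ρ') ^ 2), min (min δ ρ') (T - t₀), isC1Star_testFun J T _ _ _ _ _
      (by fun_prop), by simp [hδ, hρ'0, htT], fun t x' hx' ht' hx'r => ?_, ?_, ?_,
      fun R hR' => ?_⟩
    · have hmin : min (min δ ρ') (T - t₀) ≤ δ := (min_le_left _ _).trans (min_le_left _ _)
      obtain ⟨r, hr0, hrδ, rfl⟩ := exists_smul_of_geoDist_lt hx' hρ'
        ((min_le_left _ _).trans (min_le_right _ _)) hx'r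
      have ht2 := (abs_lt.1 (ht'.trans_le (min_le_right _ _))).2
      refine ⟨ht t (ht'.trans_le hmin), by linarith, ?_⟩
      refine (h t r (ht'.trans_le hmin) (hrδ.trans_le hmin)).trans (EReal.coe_le_coe_iff.2 ?_)
      rw [testFun_smul J _ _ _ _ _ _ _ j hr0]
      linarith
    · rw [hD, testFun_smul J _ _ _ _ _ _ _ j hρ']
      simp
    · rw [deriv_testFun, spaceDeriv_testFun J _ _ _ _ _ hΘ, hamiltonian_smul J L hρ'0,
        (hL j).legendre_deriv]
      simp
    · rw [spaceDeriv_testFun J _ _ _ _ _ hΘ]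
      exact gradAbs_le J _ fun k => (hG R).1 j q (hR R hR')

/-- The cost of covering a small distance `r = ε ^ 3` with the speed `v + ε`, followed by a cost
that is quadratic in the arrival time. -/
theorem leg_add_quadratic_le {Λ : ℝ → ℝ} {B C D E δ s₀ v p ε σ r : ℝ}
    (hv : 0 ≤ v) (hΛ : Λ (v + ε) ≤ p * (v + ε) - E + B * ε ^ 2) (hB : 0 ≤ B) (hC : 0 ≤ C)
    (hε : 0 < ε) (hr : r = ε ^ 3) (hεδ : ε ^ 2 < δ / 2) (hσ : |σ - s₀| < δ / 2) :
    |σ + r / (v + ε) - s₀| < δ ∧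
      r / (v + ε) * Λ (v + ε) + (D + E * (σ + r / (v + ε) - s₀) + C * (σ + r / (v + ε) - s₀) ^ 2)
        ≤ D + E * (σ - s₀) + p * r + (B + 2 * C) * ((σ - s₀) ^ 2 + ε ^ 4) := by
  set τ := r / (v + ε) with hτ
  have hvε : 0 < v + ε := by linarith
  have hr0 : 0 < r := by rw [hr]; positivity
  have hτ0 : 0 < τ := div_pos hr0 hvε
  have hτr : τ * (v + ε) = r := div_mul_cancel₀ _ hvε.ne'
  -- Thanks to the extra speed `ε`, this holds even when `v = 0`.
  have hτε : τ ≤ ε ^ 2 := by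
    rw [hτ, div_le_iff₀ hvε, hr]
    nlinarith [pow_pos hε 2]
  refine ⟨?_, ?_⟩
  · rw [abs_lt] at hσ ⊢
    constructor <;> linarith
  · have h1 := mul_le_mul_of_nonneg_left hΛ hτ0.le
    have h2 : τ * ε ^ 2 ≤ ε ^ 4 := by nlinarith [pow_pos hε 2]
    have h3 : τ ^ 2 ≤ ε ^ 4 := by nlinarith
    have h4 : τ * (p * (v + ε) - E + B * ε ^ 2) = p * r - E * τ + B * (τ * ε ^ 2) := by
      rw [← hτr]; ring
    have h5 := mul_le_mul_of_nonneg_left h2 hB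
    have h6 := mul_le_mul_of_nonneg_left h3 hC
    nlinarith [mul_nonneg hC (sq_nonneg (σ - s₀ - τ)), mul_nonneg hB (sq_nonneg (σ - s₀))]

end Junction

/-! ### Test functions in the starting point. -/

namespace Junction

variable {N : ℕ} [NeZero N] {J : Junction N} {i j k : Fin N} {s t : ℝ} {x y z : Plane}
  {γ : ℝ} {L : Fin N → ℝ → ℝ} {a b c m q ρ ρ' R : ℝ}

/-- Upper bound of the minimal action as a function of its starting point, near `(s₀, 0)`. -/
theorem minAction_le_of_quadratic_bound (hL : ∀ i, IsTonelli γ (L i)) (hx : x ∈ J.carrier)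
    {t₀ s₀ E D δ C : ℝ} (hE : -restCost L ≤ E) (hδ : 0 < δ) (hC : 0 ≤ C)
    (h : ∀ s, |s - s₀| < δ → s < t₀ ∧
      J.minAction L s 0 t₀ x ≤ ((D + E * (s - s₀) + C * (s - s₀) ^ 2 : ℝ) : EReal)) (k : Fin N) :
    ∃ C', ∃ κ > 0, ∀ s r, |s - s₀| < κ → 0 ≤ r → r < κ → s < t₀ ∧
      J.minAction L s (r • J.e k) t₀ x ≤ ((D + E * (s - s₀) + maxSlope (fun q => L k (-q)) E * r
        + C' * ((s - s₀) ^ 2 + r ^ (4 / 3 : ℝ)) : ℝ) : EReal) := by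
  have hT := (hL k).comp_neg
  have hEk : -(fun q => L k (-q)) 0 ≤ E := by linarith [restCost_le_neg L k]
  set v := speed (fun q => L k (-q)) E with hv
  have hv0 : 0 ≤ v := hT.speed_nonneg hEk
  obtain ⟨B, hB0, hB⟩ := hT.exists_le_quadratic (v + 1)
  -- This ensures `ε < 1`, so that the Taylor bound on `[-(v+1), v+1]` applies, and `ε² < δ / 2`.
  set κ₀ := min 1 (δ / 2)
  have hκ₀ : 0 < κ₀ := by positivity
  have hκ₁ : κ₀ ≤ 1 := min_le_left _ _
  have hκ₂ : κ₀ ≤ δ / 2 := min_le_right _ _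
  refine ⟨B + 2 * C, min (δ / 2) (κ₀ ^ 3), by positivity, fun s r hs hr hrκ => ?_⟩
  have hs' := hs.trans_le (min_le_left _ _)
  refine ⟨(h s (hs'.trans (half_lt_self hδ))).1, ?_⟩
  rcases hr.eq_or_lt with rfl | hr0
  · rw [zero_smul]
    refine (h s (hs'.trans (half_lt_self hδ))).2.trans (EReal.coe_le_coe_iff.2 ?_)
    rw [Real.zero_rpow (by norm_num)]
    nlinarith [mul_nonneg hB0 (sq_nonneg (s - s₀)), mul_nonneg hC (sq_nonneg (s - s₀))]
  -- With `ε = r^α`, the excess action is of order `r^(1+α)` and the squared delay of order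
  -- `r^(2-2α)`; `α = 1/3` balances them at `r^(4/3)`.
  · set ε := r ^ (1 / 3 : ℝ) with hε
    have hε0 : 0 < ε := Real.rpow_pos_of_pos hr0 _
    have hε3 : r = ε ^ 3 := by
      rw [hε, ← Real.rpow_natCast, ← Real.rpow_mul hr]
      norm_num
    have hε4 : r ^ (4 / 3 : ℝ) = ε ^ 4 := by
      rw [hε, ← Real.rpow_natCast (r ^ (1 / 3 : ℝ)), ← Real.rpow_mul hr]
      norm_num
    have hεκ : ε < κ₀ := by
      refine lt_of_pow_lt_pow_left₀ 3 hκ₀.le ?_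
      rw [← hε3]
      exact hrκ.trans_le (min_le_right _ _)
    have hΛ := hB v ⟨by linarith, by linarith⟩ (v + ε) ⟨by linarith, by linarith⟩
    have hΛv := hT.speed_mul_maxSlope hEk
    obtain ⟨h1, h2⟩ := leg_add_quadratic_le (Λ := fun q => L k (-q)) (D := D) (E := E)
      (p := maxSlope (fun q => L k (-q)) E) (δ := δ) hv0
      (by rw [← hv] at hΛv; rw [maxSlope, ← hv] at *; linarith) hB0 hC hε0 hε3
      (by nlinarith) hs'
    obtain ⟨h3, h4⟩ := h _ h1
    have hvε : 0 < v + ε := by linarith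
    have hleg := reach_leg J L k (s := s) (t := s + r / (v + ε)) (ρ := r) (ρ' := 0)
      (q := -(v + ε)) (by linarith [div_pos hr0 hvε]) hr le_rfl (by field_simp; ring)
    rw [zero_smul, add_sub_cancel_left] at hleg
    have hreach := hleg.trans (by linarith [div_pos hr0 hvε]) h3.le J.zero_mem_carrier
      (reach_of_minAction_le hL h3 J.zero_mem_carrier hx h4)
    refine (hreach.minAction_le (by linarith [div_pos hr0 hvε])).trans
      (EReal.coe_le_coe_iff.2 ?_)
    rw [hε4]
    exact h2

/-- Test functions that touch the minimal action from above as a function of its starting point. -/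
theorem exists_testFun_left (J : Junction N) (hL : ∀ i, IsTonelli γ (L i)) :
    ∃ C : ℝ → ℝ, ∀ (T s₀ t : ℝ) (y x : Plane), 0 < s₀ → s₀ < t → y ∈ J.carrier → x ∈ J.carrier →
      ∃ (ψ : ℝ → Plane → ℝ) (r : ℝ), J.IsC1Star T ψ ∧ 0 < r ∧
        (∀ (s : ℝ), ∀ y' ∈ J.carrier, |s - s₀| < r → J.geoDist y' y < r →
          0 < s ∧ s < t ∧ J.minAction L s y' t x ≤ (ψ s y' : EReal)) ∧
        J.minAction L s₀ y t x = (ψ s₀ y : EReal) ∧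
        -deriv (fun s => ψ s y) s₀ + J.hamiltonian L y (fun i => -J.spaceDeriv (ψ s₀) y i) ≤ 0 ∧
        (N = 1 → -deriv (fun s => ψ s y) s₀
          + legendre (L 0) (-J.spaceDeriv (ψ s₀) y 0) ≤ 0) ∧
        ∀ R, J.geoDist y x ≤ R * (t - s₀) → J.gradAbs y (J.spaceDeriv (ψ s₀) y) ≤ C R := by
  have hL' : ∀ i, IsTonelli γ ((fun k q => L k (-q)) i) := fun i => (hL i).comp_neg
  obtain ⟨Ē, V, hB⟩ := J.exists_isSpeedBound hL'
  obtain ⟨G, hG⟩ := exists_slope_bound hL' Ē V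
  refine ⟨fun R => N * G R, fun T s₀ t y x hs₀ hst hy hx => ?_⟩
  obtain ⟨j, ρ, hρ, rfl⟩ := exists_eq_smul hy
  obtain ⟨i, ρ', hρ', rfl⟩ := exists_eq_smul hx
  have hts : -t - -s₀ = s₀ - t := by ring
  rcases hρ.eq_or_lt with rfl | hρ0
  · rw [zero_smul]
    obtain ⟨E, D, δ, C, hE, hδ, hC, hD, hR, hbound, -⟩ :=
      exists_quadratic_bound_zero hL' hB i hρ' (neg_lt_neg hst)
    have hrest : restCost (fun k q => L k (-q)) = restCost L := by simp [restCost]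
    rw [hrest] at hE
    rw [minAction_reverse J hL hst J.zero_mem_carrier hx] at hD
    have hb : ∀ s, |s - s₀| < δ → s < t ∧ J.minAction L s 0 t (ρ' • J.e i) ≤
        ((D + E * (s - s₀) + C * (s - s₀) ^ 2 : ℝ) : EReal) := by
      intro s hs
      have e : -s - -s₀ = -(s - s₀) := by ring
      obtain ⟨h1, h2⟩ := hbound (-s) (by rwa [e, abs_neg])
      have h1 := neg_lt_neg_iff.1 h1
      rw [minAction_reverse J hL h1 J.zero_mem_carrier hx] at h2
      refine ⟨h1, h2.trans (EReal.coe_le_coe_iff.2 (le_of_eq ?_))⟩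
      ring
    have hk := fun k => minAction_le_of_quadratic_bound hL hx hE hδ hC hb k
    choose C' κ hκ hk using hk
    obtain ⟨C₁, hC₁⟩ := exists_forall_of_monotone (P := fun k a => C' k ≤ a)
      (fun k a b hab h => h.trans hab) fun k => ⟨_, le_rfl⟩
    have hκ' : ∃ κ' > 0, ∀ k, κ' ≤ κ k := by
      obtain ⟨l, hl⟩ := Finite.exists_min κ
      exact ⟨κ l, hκ l, hl⟩
    obtain ⟨κ', hκ'0, hκ'⟩ := hκ'
    -- Every branch gets the slope of the same energy `E`, so `-b k` is the slope of `L k` at a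
    -- nonpositive velocity of energy `E`, and each reduced Hamiltonian equals `E`. The maximizing
    -- velocity being nonpositive, the full Hamiltonian has this value too, which settles `N = 1`.
    set b : Fin N → ℝ := fun k => maxSlope (fun q => L k (-q)) E with hb
    have hΘ : HasDerivAt (fun r : ℝ => r ^ (4 / 3 : ℝ)) 0 ‖(0 : Plane)‖ := by
      have := Real.hasDerivAt_rpow_const (x := 0) (p := 4 / 3) (Or.inr (by norm_num))
      rw [norm_zero]
      refine this.congr_deriv ?_
      rw [Real.zero_rpow (by norm_num), mul_zero]
    have hΘ1 : ContDiff ℝ 1 fun r : ℝ => r ^ (4 / 3 : ℝ) :=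
      Real.contDiff_rpow_const_of_le (by norm_num)
    have hbk : ∀ k, -b k = deriv (L k) (-speed (fun q => L k (-q)) E) := fun k => by
      simp only [hb]
      rw [maxSlope, IsTonelli.deriv_comp_neg, neg_neg]
    have hsp : ∀ k, 0 ≤ speed (fun q => L k (-q)) E ∧
        energy (L k) (-speed (fun q => L k (-q)) E) = E := fun k => by
      rw [← energy_comp_neg]
      exact ⟨(hL k).comp_neg.speed_nonneg (by linarith [restCost_le_neg L k]),
        (hL k).comp_neg.energy_speed (by linarith [restCost_le_neg L k])⟩
    refine ⟨J.testFun D E s₀ b C₁ fun r => r ^ (4 / 3 : ℝ), min κ' s₀,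
      isC1Star_testFun J T _ _ _ _ _ hΘ1, lt_min hκ'0 hs₀, fun s y' hy' hs hy'r => ?_, ?_, ?_,
      fun hN => ?_, fun R hR' => ?_⟩
    · obtain ⟨k, r, hr, hrκ, rfl⟩ := exists_smul_of_geoDist_zero_lt hy' hy'r
      have hs1 := (abs_lt.1 (hs.trans_le (min_le_right _ _))).1
      obtain ⟨h1, h2⟩ := hk k s r (hs.trans_le ((min_le_left _ _).trans (hκ' k))) hr
        (hrκ.trans_le ((min_le_left _ _).trans (hκ' k)))
      refine ⟨by linarith, h1, h2.trans (EReal.coe_le_coe_iff.2 ?_)⟩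
      rw [testFun_smul J _ _ _ _ _ _ _ k hr]
      have h3 : 0 ≤ (s - s₀) ^ 2 + r ^ (4 / 3 : ℝ) := by positivity
      have := mul_le_mul_of_nonneg_right (hC₁ k) h3
      simp only [hb]
      linarith
    · rw [hD, ← zero_smul ℝ (J.e i), testFun_smul J _ _ _ _ _ _ _ i le_rfl,
        Real.zero_rpow (by norm_num)]
      simp
    · rw [deriv_testFun, spaceDeriv_testFun J _ _ _ _ _ hΘ, hamiltonian, if_pos rfl]
      have : (⨆ k, legendreNeg (L k) (-b k)) ≤ E := ciSup_le fun k => by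
        rw [hbk, (hL k).legendreNeg_deriv (neg_nonpos.2 (hsp k).1), (hsp k).2]
      linarith
    · rw [deriv_testFun, spaceDeriv_testFun J _ _ _ _ _ hΘ, hbk, (hL 0).legendre_deriv, (hsp 0).2]
      simp
    · rw [spaceDeriv_testFun J _ _ _ _ _ hΘ]
      refine gradAbs_le J _ fun k => (hG R).1 k _ ?_
      rw [abs_of_nonneg (hsp k).1]
      refine (hB.speed_le R k E (hR R ?_)).1
      rw [geoDist_comm J hx J.zero_mem_carrier]
      refine hR'.trans_eq ?_
      ring
  · obtain ⟨δ, hδ, C, hC, hs, hr, H⟩ := exists_quadratic_bound hL' hB i j hρ' (neg_lt_neg hst) hρ0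
    obtain ⟨D, q, hD, hR, h⟩ := H (-s₀) ρ (by simpa using hδ) (by simpa using hδ)
    rw [minAction_reverse J hL hst hy hx] at hD
    have hΘ : HasDerivAt (fun r : ℝ => (r - ρ) ^ 2) 0 ‖ρ • J.e j‖ := by
      rw [norm_smul_e j hρ]
      simpa using ((hasDerivAt_id' ρ).sub_const ρ).fun_pow 2
    have hb : -deriv (fun q => L j (-q)) q = deriv (L j) (-q) := by
      rw [IsTonelli.deriv_comp_neg, neg_neg]
    refine ⟨J.testFun (D - deriv (fun q => L j (-q)) q * ρ) (energy (L j) (-q)) s₀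
      (fun _ => deriv (fun q => L j (-q)) q) C (fun r => (r - ρ) ^ 2), min (min δ ρ) s₀,
      isC1Star_testFun J T _ _ _ _ _ (by fun_prop), by simp [hδ, hρ0, hs₀],
      fun s y' hy' hs' hy'r => ?_, ?_, ?_, fun hN => ?_, fun R hR' => ?_⟩
    · have hmin : min (min δ ρ) s₀ ≤ δ := (min_le_left _ _).trans (min_le_left _ _)
      obtain ⟨r, hr0, hrδ, rfl⟩ := exists_smul_of_geoDist_lt hy' hρ
        ((min_le_left _ _).trans (min_le_right _ _)) hy'r
      have hs2 := (abs_lt.1 (hs'.trans_le (min_le_right _ _))).1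
      have e : -s - -s₀ = -(s - s₀) := by ring
      have hs3 : |-s - -s₀| < δ := by rw [e, abs_neg]; exact hs'.trans_le hmin
      have hst' : s < t := neg_lt_neg_iff.1 (hs (-s) hs3)
      have h1 := h (-s) r hs3 (hrδ.trans_le hmin)
      rw [minAction_reverse J hL hst' (smul_mem_carrier j hr0) hx] at h1
      refine ⟨by linarith, hst', h1.trans (EReal.coe_le_coe_iff.2 (le_of_eq ?_))⟩
      rw [testFun_smul J _ _ _ _ _ _ _ j hr0, energy_comp_neg]
      ring
    · rw [hD, testFun_smul J _ _ _ _ _ _ _ j hρ]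
      simp
    · rw [deriv_testFun, spaceDeriv_testFun J _ _ _ _ _ hΘ, hamiltonian_smul J L hρ0, hb,
        (hL j).legendre_deriv]
      simp
    · have hj : (0 : Fin N) = j := by
        have : Subsingleton (Fin N) := by rw [hN]; infer_instance
        exact Subsingleton.elim _ _
      rw [deriv_testFun, spaceDeriv_testFun J _ _ _ _ _ hΘ, hj, hb, (hL j).legendre_deriv]
      simp
    · rw [spaceDeriv_testFun J _ _ _ _ _ hΘ]
      refine gradAbs_le J _ fun k => (hG R).1 j q (hR R ?_)
      rw [geoDist_comm J hx hy]
      refine hR'.trans_eq ?_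
      ring

end Junction

end

theorem theorem4p2 {N : ℕ} [NeZero N] (J : Junction N) (L : Fin N → ℝ → ℝ)
    (hA1 : ∃ γ : ℝ, 0 < γ ∧ ∀ i, ContDiff ℝ 2 (L i) ∧ ∀ q, γ ≤ iteratedDeriv 2 (L i) q) :
    -- finiteness
    (∀ (s t : ℝ) (y x : Plane), 0 ≤ s → s < t → y ∈ J.carrier → x ∈ J.carrier →
      J.minAction L s y t x ≠ ⊥ ∧ J.minAction L s y t x ≠ ⊤) ∧
    -- continuity for `0 < s < t`
    ContinuousOn (fun z : (ℝ × Plane) × (ℝ × Plane) => J.minAction L z.1.1 z.1.2 z.2.1 z.2.2)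
      {z | 0 < z.1.1 ∧ z.1.1 < z.2.1 ∧ z.1.2 ∈ J.carrier ∧ z.2.2 ∈ J.carrier} ∧
    -- lower semi-continuity for `0 < s ≤ t`
    LowerSemicontinuousOn
      (fun z : (ℝ × Plane) × (ℝ × Plane) => J.minAction L z.1.1 z.1.2 z.2.1 z.2.2)
      {z | 0 < z.1.1 ∧ z.1.1 ≤ z.2.1 ∧ z.1.2 ∈ J.carrier ∧ z.2.2 ∈ J.carrier} ∧
    -- test functions; `C` depends only on the junction and the Lagrangians
    (∃ C : ℝ → ℝ, ∀ (T s₀ t₀ : ℝ) (y₀ x₀ : Plane), 0 < s₀ → s₀ < t₀ → t₀ < T →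
      y₀ ∈ J.carrier → x₀ ∈ J.carrier →
      ∃ (φ ψ : ℝ → Plane → ℝ) (r : ℝ), J.IsC1Star T φ ∧ J.IsC1Star T ψ ∧ 0 < r ∧
        -- `φ` touches `D(s₀, y₀; ·, ·)` from above at `(t₀, x₀)`
        (∀ (t : ℝ), ∀ x ∈ J.carrier, |t - t₀| < r → J.geoDist x x₀ < r →
          s₀ < t ∧ t < T ∧ J.minAction L s₀ y₀ t x ≤ (φ t x : EReal)) ∧
        J.minAction L s₀ y₀ t₀ x₀ = (φ t₀ x₀ : EReal) ∧
        0 ≤ deriv (fun t => φ t x₀) t₀ + J.hamiltonian L x₀ (J.spaceDeriv (φ t₀) x₀) ∧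
        -- `ψ` touches `D(·, ·; t₀, x₀)` from above at `(s₀, y₀)`
        (∀ (s : ℝ), ∀ y ∈ J.carrier, |s - s₀| < r → J.geoDist y y₀ < r →
          0 < s ∧ s < t₀ ∧ J.minAction L s y t₀ x₀ ≤ (ψ s y : EReal)) ∧
        J.minAction L s₀ y₀ t₀ x₀ = (ψ s₀ y₀ : EReal) ∧
        (2 ≤ N → -deriv (fun s => ψ s y₀) s₀
          + J.hamiltonian L y₀ (fun i => -J.spaceDeriv (ψ s₀) y₀ i) ≤ 0) ∧
        (N = 1 → -deriv (fun s => ψ s y₀) s₀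
          + Junction.legendre (L 0) (-J.spaceDeriv (ψ s₀) y₀ 0) ≤ 0) ∧
        -- gradient bound
        (∀ R > 0, J.geoDist y₀ x₀ ≤ R * (t₀ - s₀) →
          J.gradAbs x₀ (J.spaceDeriv (φ t₀) x₀) + J.gradAbs y₀ (J.spaceDeriv (ψ s₀) y₀) ≤ C R)) ∧
    -- local semi-concavity in `(t, x)` and in `(s, y)` along the open branches
    (∀ (s₀ : ℝ), ∀ y₀ ∈ J.carrier, 0 < s₀ → ∀ i,
      LocallySemiconcaveOn (fun z => (J.minAction L s₀ y₀ z.1 (z.2 • J.e i)).toReal)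
        (Ioi s₀ ×ˢ Ioi 0)) ∧
    (∀ (t₀ : ℝ), ∀ x₀ ∈ J.carrier, 0 < t₀ → ∀ j,
      LocallySemiconcaveOn (fun z => (J.minAction L z.1 (z.2 • J.e j) t₀ x₀).toReal)
        (Ioo 0 t₀ ×ˢ Ioi 0)) := by
  obtain ⟨γ, hγ, hL⟩ := hA1
  have hL : ∀ i, IsTonelli γ (L i) := fun i => ⟨hγ, (hL i).1, (hL i).2⟩
  refine ⟨fun s t y x _ hst hy hx => Junction.minAction_ne_bot_ne_top hL hst hy hx,
    (J.continuousOn_minAction hL).mono fun z hz => hz.2,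
    (J.lowerSemicontinuousOn_minAction hL).mono fun z hz => hz.2, ?_,
    fun s₀ y₀ hy _ i => J.locallySemiconcaveOn_minAction_right hL s₀ hy i,
    fun t₀ x₀ hx _ j => J.locallySemiconcaveOn_minAction_left hL t₀ hx j⟩
  obtain ⟨C₁, h₁⟩ := J.exists_testFun_right hL
  obtain ⟨C₂, h₂⟩ := J.exists_testFun_left hL
  refine ⟨fun R => C₁ R + C₂ R, fun T s₀ t₀ y₀ x₀ hs₀ hst htT hy hx => ?_⟩
  obtain ⟨φ, r₁, hφ, hr₁, hφle, hφeq, hφH, hφg⟩ := h₁ T s₀ t₀ y₀ x₀ hst htT hy hx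
  obtain ⟨ψ, r₂, hψ, hr₂, hψle, hψeq, hψH, hψ1, hψg⟩ := h₂ T s₀ t₀ y₀ x₀ hs₀ hst hy hx
  exact ⟨φ, ψ, min r₁ r₂, hφ, hψ, lt_min hr₁ hr₂,
    fun t x hx ht hd => hφle t x hx (ht.trans_le (min_le_left _ _)) (hd.trans_le (min_le_left _ _)),
    hφeq, hφH,
    fun s y hy hs hd => hψle s y hy (hs.trans_le (min_le_right _ _))
      (hd.trans_le (min_le_right _ _)),
    hψeq, fun _ => hψH, hψ1, fun R _ hR => add_le_add (hφg R hR) (hψg R hR)⟩
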